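/- Throughout, a potential is a real-valued function $q\in L^1(\mathbb R)$ with $\operatorname{supp} q\subset[-1,1]$. For $z\in\mathbb C$ let $f^{\pm}(\cdot,z)$ be the Jost solutions, i.e. the unique solutions of $-y''+qy=z^2y$ on $\mathbb R$ with $f^+(x,z)=e^{izx}$ for $x\ge 1$ and $f^-(x,z)=e^{-izx}$ for $x\le -1$. With $[f,g]=fg'-f'g$ the Wronskian, put $s(z)=s_q(z)=[f^+(\cdot,z),f^-(\cdot,-z)]$ (independent of $x$); this is an entire function of $z$. For $Q,\delta>0$ let $B_\delta(Q)$ be the set of potentials with $\|q\|_1\le Q$ and $|s_q(0)|\ge\delta$. For $q,\tilde q\in B_\delta(Q)$ write $s=s_q$, $\tilde s=s_{\tilde q}$. For $R>0$ and $\varepsilon'\ge 0$, the zeros of $s$ and $\tilde s$ are called $\varepsilon'$-close in the open disk $\mathcal D(R)=\{|z|<R\}$ if $s$ and $\tilde s$ have the same number $N'$ of zeros in $\mathcal D(R)$, counted with multiplicity, and these can be enumerated (with multiplicity) as $s_1,\dots,s_{N'}$ and $\tilde s_1,\dots,\tilde s_{N'}$ so that $|s_n-\tilde s_n|\le\varepsilon'$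 for $1\le n\le N'$. **Theorem.** For all $Q,\delta>0$ there are positive constants $R_0'=R_0'(Q,\delta)$ and $C'=C'(Q,\delta)$ such that for every $R\ge R_0'$ there is a constant $E'=E'(Q,R)>0$ with the following property. Let $q,\tilde q\in B_\delta(Q)$ satisfy $s'(0)/s(0)=\tilde s'(0)/\tilde s(0)$, let $\varepsilon'\in[0,E']$ and $\eta\in(\varepsilon',1)$, and suppose that the zeros of $s$ and $\tilde s$ are $\varepsilon'$-close in $\mathcal D(R)$. Then for every real $z$ with $|z|\le R^{1/3}$ and $|z-s_n|\ge\eta$ for $1\le n\le N'$, $$|s(z)-\tilde s(z)|\le C'\left[\eta^{-1}\varepsilon' N'+R^{-1/3}+(1+|z|)\varepsilon' N'+|s(0)-\tilde s(0)|\right].$$ Here $R_0'$ and $C'$ depend only on $Q$ and $\delta$, and $E'$ depends only on $Q$ and $R$. -/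

import Mathlib

open Set MeasureTheory Filter Topology

noncomputable section

/-- `y` solves `-y'' + q y = z² y` on `ℝ` in the usual (Carathéodory) sense for a locally
integrable potential `q`: `y` is continuously differentiable, and `y'` is a primitive of
`(q - z²) y` (so `y'` is locally absolutely continuous and `y'' = (q - z²) y` almost everywhere). -/
def IsSchrodingerSolution (q : ℝ → ℝ) (z : ℂ) (y : ℝ → ℂ) : Prop :=
  ContDiff ℝ 1 y ∧
    ∀ a b : ℝ, deriv y b - deriv y a = ∫ t in a..b, ((q t : ℂ) - z ^ 2) * y t

/-- `y` is the Jost solution `f⁺(·, z)` of a potential supported in `[-1, 1]`. -/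
def IsJostPlus (q : ℝ → ℝ) (z : ℂ) (y : ℝ → ℂ) : Prop :=
  IsSchrodingerSolution q z y ∧ ∀ x : ℝ, 1 ≤ x → y x = Complex.exp (Complex.I * z * x)

/-- `y` is the Jost solution `f⁻(·, z)` of a potential supported in `[-1, 1]`. -/
def IsJostMinus (q : ℝ → ℝ) (z : ℂ) (y : ℝ → ℂ) : Prop :=
  IsSchrodingerSolution q z y ∧ ∀ x : ℝ, x ≤ -1 → y x = Complex.exp (-(Complex.I * z * x))

/-- `q` is a real-valued integrable potential whose (essential) support lies in `[-1, 1]`. -/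
def IsPotential (q : ℝ → ℝ) : Prop :=
  Integrable q ∧ ∀ᵐ x : ℝ, x ∉ Icc (-1 : ℝ) 1 → q x = 0

namespace Jost

/-- The right-hand side of the first order system for `(y, y')`. -/
def rhs (q : ℝ → ℝ) (z : ℂ) (t : ℝ) (u : ℂ × ℂ) : ℂ × ℂ :=
  (u.2, ((q t : ℂ) - z ^ 2) * u.1)

lemma rhs_integrable {q : ℝ → ℝ} (hq : Integrable q) (z : ℂ) {u : ℝ → ℂ × ℂ}
    (hu : Continuous u) (a b : ℝ) :
    IntervalIntegrable (fun t => rhs q z t (u t)) volume a b := by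
  have h1 : IntervalIntegrable (fun t => (u t).2) volume a b :=
    (continuous_snd.comp hu).intervalIntegrable a b
  have h2 : IntervalIntegrable (fun t => ((q t : ℂ) - z ^ 2) * (u t).1) volume a b := by
    apply IntervalIntegrable.mul_continuousOn
    · exact (hq.ofReal.intervalIntegrable).sub intervalIntegrable_const
    · exact (continuous_fst.comp hu).continuousOn
  constructor
  · exact h1.1.prodMk h2.1
  · exact h1.2.prodMk h2.2

/-- A constant with which exponential weights make the integral operator contract. -/
lemma exists_weight {q : ℝ → ℝ} (hq : Integrable q) (z : ℂ) :
    ∃ k : ℝ, 0 < k ∧ ∀ (u : ℝ → ℂ × ℂ), Continuous u → ∀ x₀ x K : ℝ, 0 ≤ K →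
      (∀ t ∈ uIcc x₀ x, ‖u t‖ ≤ K * Real.exp (k * |t - x₀|)) →
      ‖∫ t in x₀..x, rhs q z t (u t)‖ ≤ K / 2 * Real.exp (k * |x - x₀|) := by
  obtain ⟨g, hgc, hg, hgcont, hgint⟩ :=
    hq.exists_hasCompactSupport_integral_sub_le (ε := 1 / 4) (by norm_num)
  obtain ⟨C, hC⟩ := hgc.exists_bound_of_continuous hgcont
  have hC0 : 0 ≤ C := (norm_nonneg _).trans (hC 0)
  set D : ℝ := 1 + C + ‖z‖ ^ 2 with hD
  have hDpos : 0 < D := by positivity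
  have hr : Integrable (fun t => ‖q t - g t‖) := (hq.sub hgint).norm
  have hrhs : ∀ t (v : ℂ × ℂ), ‖rhs q z t v‖ ≤ (D + ‖q t - g t‖) * ‖v‖ := by
    intro t v
    have e1 : ‖v.1‖ ≤ ‖v‖ := norm_fst_le v
    have e2 : ‖v.2‖ ≤ ‖v‖ := norm_snd_le v
    have e3 : 0 ≤ ‖q t - g t‖ := norm_nonneg _
    have e4 : ‖(q t : ℂ) - z ^ 2‖ ≤ D - 1 + ‖q t - g t‖ := by
      have h1 : ‖(q t : ℂ) - z ^ 2‖ ≤ ‖(q t : ℂ)‖ + ‖z‖ ^ 2 := by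
        rw [← norm_pow]
        exact norm_sub_le (q t : ℂ) (z ^ 2)
      have h2 : ‖(q t : ℂ)‖ ≤ ‖q t - g t‖ + C := by
        rw [Complex.norm_real]
        calc ‖q t‖ = ‖(q t - g t) + g t‖ := by ring_nf
          _ ≤ ‖q t - g t‖ + ‖g t‖ := norm_add_le _ _
          _ ≤ _ := by gcongr; exact hC t
      rw [hD]; linarith
    have hnn : 0 ≤ ‖v‖ := norm_nonneg v
    rw [rhs, Prod.norm_def]
    apply max_le
    · show ‖v.2‖ ≤ _
      have hD1 : 1 ≤ D := by rw [hD]; nlinarith [sq_nonneg ‖z‖]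
      nlinarith
    · show ‖((q t : ℂ) - z ^ 2) * v.1‖ ≤ _
      rw [norm_mul]
      calc _ ≤ (D - 1 + ‖q t - g t‖) * ‖v‖ :=
            mul_le_mul e4 e1 (norm_nonneg _) ((norm_nonneg _).trans e4)
        _ ≤ _ := by gcongr; linarith
  refine ⟨4 * D, by positivity, ?_⟩
  intro u hu x₀ x K hK hb
  set k := 4 * D with hk
  have hkpos : 0 < k := by positivity
  set W := Real.exp (k * |x - x₀|) with hW
  have habs : ∀ t ∈ uIcc x₀ x, |t - x₀| ≤ |x - x₀| := fun t ht => abs_sub_left_of_mem_uIcc ht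
  -- pointwise bound of the integrand
  have hpt : ∀ t ∈ uIcc x₀ x, ‖rhs q z t (u t)‖ ≤
      D * K * Real.exp (k * |t - x₀|) + K * W * ‖q t - g t‖ := by
    intro t ht
    have h1 := hb t ht
    have h2 : Real.exp (k * |t - x₀|) ≤ W := by
      apply Real.exp_le_exp.2
      exact mul_le_mul_of_nonneg_left (habs t ht) hkpos.le
    calc _ ≤ (D + ‖q t - g t‖) * ‖u t‖ := hrhs _ _
      _ ≤ (D + ‖q t - g t‖) * (K * Real.exp (k * |t - x₀|)) := by gcongr
      _ = D * K * Real.exp (k * |t - x₀|) + K * Real.exp (k * |t - x₀|) * ‖q t - g t‖ := by ring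
      _ ≤ _ := by gcongr
  have hcexp : Continuous fun t : ℝ => Real.exp (k * |t - x₀|) := by fun_prop
  -- the integral of the exponential weight
  have hexp : |∫ t in x₀..x, Real.exp (k * |t - x₀|)| ≤ W / k := by
    rcases le_total x₀ x with h | h
    · have e : ∫ t in x₀..x, Real.exp (k * |t - x₀|) = (W - 1) / k := by
        have : ∫ t in x₀..x, Real.exp (k * |t - x₀|) = ∫ t in x₀..x, Real.exp (k * (t - x₀)) := by
          apply intervalIntegral.integral_congr
          intro t ht
          rw [uIcc_of_le h] at ht
          simp only [abs_of_nonneg (sub_nonneg.2 ht.1)]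
        rw [this, intervalIntegral.integral_eq_sub_of_hasDerivAt
          (f := fun t => Real.exp (k * (t - x₀)) / k)]
        · rw [hW, abs_of_nonneg (sub_nonneg.2 h)]; simp; ring
        · intro t _
          have := (((hasDerivAt_id t).sub_const x₀).const_mul k).exp.div_const k
          refine this.congr_deriv ?_
          show Real.exp (k * (t - x₀)) * (k * 1) / k = _
          field_simp
        · exact (by fun_prop : Continuous fun t : ℝ => Real.exp (k * (t - x₀))).intervalIntegrable _ _
      have hW1 : 1 ≤ W := Real.one_le_exp (by positivity)
      rw [e, abs_of_nonneg (div_nonneg (by linarith) hkpos.le)]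
      gcongr; linarith
    · have e : ∫ t in x₀..x, Real.exp (k * |t - x₀|) = -((W - 1) / k) := by
        have : ∫ t in x₀..x, Real.exp (k * |t - x₀|) = ∫ t in x₀..x, Real.exp (k * (x₀ - t)) := by
          apply intervalIntegral.integral_congr
          intro t ht
          rw [uIcc_of_ge h] at ht
          simp only [abs_of_nonpos (sub_nonpos.2 ht.2), neg_sub]
        rw [this, intervalIntegral.integral_eq_sub_of_hasDerivAt
          (f := fun t => -(Real.exp (k * (x₀ - t)) / k))]
        · rw [hW, abs_of_nonpos (sub_nonpos.2 h)]; simp; ring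
        · intro t _
          have := ((((hasDerivAt_id t).const_sub x₀).const_mul k).exp.div_const k).fun_neg
          refine this.congr_deriv ?_
          show -(Real.exp (k * (x₀ - t)) * (k * -1) / k) = _
          field_simp
        · exact (by fun_prop : Continuous fun t : ℝ => Real.exp (k * (x₀ - t))).intervalIntegrable _ _
      have hW1 : 1 ≤ W := Real.one_le_exp (by positivity)
      rw [e, abs_neg, abs_of_nonneg (div_nonneg (by linarith) hkpos.le)]
      gcongr; linarith
  have hrint : |∫ t in x₀..x, ‖q t - g t‖| ≤ 1 / 4 := by
    have h1 := intervalIntegral.norm_integral_le_integral_norm_uIoc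
      (f := fun t => ‖q t - g t‖) (a := x₀) (b := x) (μ := volume)
    simp only [norm_norm] at h1
    rw [Real.norm_eq_abs] at h1
    refine h1.trans (le_trans ?_ hg)
    exact setIntegral_le_integral hr (Eventually.of_forall fun t => norm_nonneg _)
  have hint1 : IntervalIntegrable (fun t => D * K * Real.exp (k * |t - x₀|)) volume x₀ x :=
    (hcexp.const_mul _).intervalIntegrable _ _
  have hint2 : IntervalIntegrable (fun t => K * W * ‖q t - g t‖) volume x₀ x :=
    (hr.const_mul _).intervalIntegrable
  have hWpos : 0 < W := Real.exp_pos _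
  calc ‖∫ t in x₀..x, rhs q z t (u t)‖
      ≤ |∫ t in x₀..x, (D * K * Real.exp (k * |t - x₀|) + K * W * ‖q t - g t‖)| := by
        apply intervalIntegral.norm_integral_le_abs_of_norm_le _ (hint1.add hint2)
        exact (ae_restrict_iff' measurableSet_uIoc).2
          (Eventually.of_forall fun t ht => hpt t (uIoc_subset_uIcc ht))
    _ = |D * K * (∫ t in x₀..x, Real.exp (k * |t - x₀|)) +
          K * W * ∫ t in x₀..x, ‖q t - g t‖| := by
        rw [intervalIntegral.integral_add hint1 hint2, intervalIntegral.integral_const_mul,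
          intervalIntegral.integral_const_mul]
    _ ≤ D * K * (W / k) + K * W * (1 / 4) := by
        refine (abs_add_le _ _).trans ?_
        rw [abs_mul (D * K), abs_mul (K * W), abs_of_nonneg (by positivity : 0 ≤ D * K),
          abs_of_nonneg (by positivity : 0 ≤ K * W)]
        gcongr
    _ = K / 2 * W := by rw [hk]; field_simp; ring

/-- Existence for the first order system on the whole line. -/
lemma exists_system {q : ℝ → ℝ} (hq : Integrable q) (z : ℂ) (x₀ : ℝ) (c : ℂ × ℂ) :
    ∃ u : ℝ → ℂ × ℂ, Continuous u ∧ ∀ x, u x = c + ∫ t in x₀..x, rhs q z t (u t) := by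
  obtain ⟨k, hk, hkb⟩ := exists_weight hq z
  have hcW : Continuous fun t : ℝ => Real.exp (k * |t - x₀|) := by fun_prop
  have hcV : Continuous fun t : ℝ => Real.exp (-(k * |t - x₀|)) := by fun_prop
  let lift : BoundedContinuousFunction ℝ (ℂ × ℂ) → ℝ → ℂ × ℂ :=
    fun φ t => Real.exp (k * |t - x₀|) • φ t
  have hlc : ∀ φ, Continuous (lift φ) := fun φ => hcW.smul φ.continuous
  have hprim : ∀ φ, Continuous fun x => ∫ t in x₀..x, rhs q z t (lift φ t) := fun φ =>
    intervalIntegral.continuous_primitive (fun a b => rhs_integrable hq z (hlc φ) a b) x₀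
  have hlb : ∀ φ : BoundedContinuousFunction ℝ (ℂ × ℂ), ∀ t,
      ‖lift φ t‖ ≤ ‖φ‖ * Real.exp (k * |t - x₀|) := by
    intro φ t
    simp only [lift, norm_smul, Real.norm_eq_abs, Real.abs_exp]
    rw [mul_comm]
    gcongr
    exact φ.norm_coe_le_norm t
  have hib : ∀ φ x, ‖∫ t in x₀..x, rhs q z t (lift φ t)‖ ≤
      ‖φ‖ / 2 * Real.exp (k * |x - x₀|) := fun φ x =>
    hkb _ (hlc φ) x₀ x _ (norm_nonneg _) (fun t _ => hlb φ t)
  have hVW : ∀ x, Real.exp (-(k * |x - x₀|)) * Real.exp (k * |x - x₀|) = 1 := by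
    intro x; rw [← Real.exp_add]; simp
  let T : BoundedContinuousFunction ℝ (ℂ × ℂ) → BoundedContinuousFunction ℝ (ℂ × ℂ) := fun φ =>
    BoundedContinuousFunction.ofNormedAddCommGroup
      (fun x => Real.exp (-(k * |x - x₀|)) • (c + ∫ t in x₀..x, rhs q z t (lift φ t)))
      (hcV.smul (continuous_const.add (hprim φ))) (‖c‖ + ‖φ‖ / 2) (by
        intro x
        have h1 : Real.exp (-(k * |x - x₀|)) ≤ 1 := Real.exp_le_one_iff.2 (by
          have := abs_nonneg (x - x₀); nlinarith)
        rw [norm_smul, Real.norm_eq_abs, Real.abs_exp]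
        calc _ ≤ Real.exp (-(k * |x - x₀|)) * (‖c‖ + ‖φ‖ / 2 * Real.exp (k * |x - x₀|)) := by
              gcongr
              exact (norm_add_le _ _).trans (by gcongr; exact hib φ x)
          _ = Real.exp (-(k * |x - x₀|)) * ‖c‖ + ‖φ‖ / 2 *
              (Real.exp (-(k * |x - x₀|)) * Real.exp (k * |x - x₀|)) := by ring
          _ ≤ _ := by
              rw [hVW, mul_one]
              gcongr
              nlinarith [norm_nonneg c])
  have hT : ContractingWith (1 / 2) T := by
    refine ⟨by norm_num, LipschitzWith.of_dist_le_mul fun φ ψ => ?_⟩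
    rw [BoundedContinuousFunction.dist_le (by positivity)]
    intro x
    have hsub : (∫ t in x₀..x, rhs q z t (lift φ t)) - ∫ t in x₀..x, rhs q z t (lift ψ t) =
        ∫ t in x₀..x, rhs q z t (lift (φ - ψ) t) := by
      rw [← intervalIntegral.integral_sub (rhs_integrable hq z (hlc φ) _ _)
        (rhs_integrable hq z (hlc ψ) _ _)]
      congr 1
      ext t <;> simp [rhs, lift] <;> ring
    show dist (Real.exp (-(k * |x - x₀|)) • (c + ∫ t in x₀..x, rhs q z t (lift φ t)))
      (Real.exp (-(k * |x - x₀|)) • (c + ∫ t in x₀..x, rhs q z t (lift ψ t))) ≤ _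
    rw [dist_eq_norm, ← smul_sub, add_sub_add_left_eq_sub, hsub, norm_smul, Real.norm_eq_abs,
      Real.abs_exp, dist_eq_norm]
    calc _ ≤ Real.exp (-(k * |x - x₀|)) * (‖φ - ψ‖ / 2 * Real.exp (k * |x - x₀|)) := by
          gcongr; exact hib _ x
      _ = ‖φ - ψ‖ / 2 * (Real.exp (-(k * |x - x₀|)) * Real.exp (k * |x - x₀|)) := by ring
      _ ≤ _ := by rw [hVW]; push_cast; linarith
  obtain ⟨φ, hφ⟩ : ∃ φ, T φ = φ := ⟨_, hT.fixedPoint_isFixedPt⟩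
  refine ⟨lift φ, hlc φ, fun x => ?_⟩
  have h1 : φ x = Real.exp (-(k * |x - x₀|)) • (c + ∫ t in x₀..x, rhs q z t (lift φ t)) :=
    (DFunLike.congr_fun hφ x).symm
  have h2 : lift φ x = Real.exp (k * |x - x₀|) • φ x := rfl
  rw [h2, h1, smul_smul, mul_comm, hVW, one_smul]

/-- Uniqueness for the first order system, on the interval between `x₀` and `x`. -/
lemma system_unique {q : ℝ → ℝ} (hq : Integrable q) (z : ℂ) {x₀ x : ℝ} {u v : ℝ → ℂ × ℂ}
    (hu : Continuous u) (hv : Continuous v)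
    (h : ∀ y ∈ uIcc x₀ x, u y - v y = ∫ t in x₀..y, rhs q z t (u t - v t)) :
    u x = v x := by
  obtain ⟨k, hk, hkb⟩ := exists_weight hq z
  have hc : Continuous fun t => Real.exp (-(k * |t - x₀|)) * ‖u t - v t‖ := by fun_prop
  obtain ⟨m, hm, hmax⟩ := isCompact_uIcc.exists_isMaxOn (nonempty_uIcc (a := x₀) (b := x))
    hc.continuousOn
  set K := Real.exp (-(k * |m - x₀|)) * ‖u m - v m‖ with hK
  have hK0 : 0 ≤ K := by positivity
  have hVW : ∀ x, Real.exp (-(k * |x - x₀|)) * Real.exp (k * |x - x₀|) = 1 := by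
    intro x; rw [← Real.exp_add]; simp
  have hb : ∀ t ∈ uIcc x₀ x, ‖u t - v t‖ ≤ K * Real.exp (k * |t - x₀|) := by
    intro t ht
    have h1 : Real.exp (-(k * |t - x₀|)) * ‖u t - v t‖ ≤ K := hmax ht
    calc ‖u t - v t‖ = (Real.exp (-(k * |t - x₀|)) * ‖u t - v t‖) * Real.exp (k * |t - x₀|) := by
          rw [mul_right_comm, hVW, one_mul]
      _ ≤ _ := by gcongr
  have h2 := hkb (fun t => u t - v t) (hu.sub hv) x₀ m K hK0
    (fun t ht => hb t (uIcc_subset_uIcc left_mem_uIcc hm ht))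
  rw [← h m hm] at h2
  have h3 : K ≤ K / 2 := by
    calc K ≤ Real.exp (-(k * |m - x₀|)) * (K / 2 * Real.exp (k * |m - x₀|)) := by
          rw [hK]; gcongr
      _ = K / 2 * (Real.exp (-(k * |m - x₀|)) * Real.exp (k * |m - x₀|)) := by ring
      _ = K / 2 := by rw [hVW, mul_one]
  have h4 : K = 0 := by linarith
  have h5 := hb x right_mem_uIcc
  rw [h4, zero_mul] at h5
  exact sub_eq_zero.1 (norm_le_zero_iff.1 h5)

lemma rhs_sub (q : ℝ → ℝ) (z : ℂ) (t : ℝ) (u v : ℂ × ℂ) :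
    rhs q z t (u - v) = rhs q z t u - rhs q z t v := by
  ext <;> simp [rhs]; ring

lemma fst_integral {f : ℝ → ℂ × ℂ} {a b : ℝ} (hf : IntervalIntegrable f volume a b) :
    (∫ t in a..b, f t).1 = ∫ t in a..b, (f t).1 :=
  ((ContinuousLinearMap.fst ℝ ℂ ℂ).intervalIntegral_comp_comm hf).symm

lemma snd_integral {f : ℝ → ℂ × ℂ} {a b : ℝ} (hf : IntervalIntegrable f volume a b) :
    (∫ t in a..b, f t).2 = ∫ t in a..b, (f t).2 :=
  ((ContinuousLinearMap.snd ℝ ℂ ℂ).intervalIntegral_comp_comm hf).symm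

/-- A solution of the equation gives a solution of the system. -/
lemma system_of_solution {q : ℝ → ℝ} (hq : Integrable q) {z : ℂ} {y : ℝ → ℂ}
    (hy : IsSchrodingerSolution q z y) (a b : ℝ) :
    ((y b, deriv y b) : ℂ × ℂ) - (y a, deriv y a) =
      ∫ t in a..b, rhs q z t (y t, deriv y t) := by
  have hd : Continuous (deriv y) := hy.1.continuous_deriv le_rfl
  have hu : Continuous fun t => ((y t, deriv y t) : ℂ × ℂ) := hy.1.continuous.prodMk hd
  have hi := rhs_integrable hq z hu a b
  ext
  · rw [fst_integral hi]
    simp only [rhs, Prod.fst_sub]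
    exact (intervalIntegral.integral_deriv_eq_sub
      (fun t _ => (hy.1.differentiable one_ne_zero) t) (hd.intervalIntegrable _ _)).symm
  · rw [snd_integral hi]
    exact hy.2 a b

end Jost

open Jost in
/-- The Jost solution `f⁺(·, z)` exists and is unique. -/
theorem existsUnique_isJostPlus {q : ℝ → ℝ} (hq : IsPotential q) (z : ℂ) :
    ∃! y : ℝ → ℂ, IsJostPlus q z y := by
  obtain ⟨hqi, hqs⟩ := hq
  apply existsUnique_of_exists_of_unique
  · obtain ⟨u, hu, hux⟩ := exists_system hqi z 1
      (Complex.exp (Complex.I * z), Complex.I * z * Complex.exp (Complex.I * z))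
    have hi := fun a b => rhs_integrable hqi z hu a b
    have hdiff : ∀ a b, u b - u a = ∫ t in a..b, rhs q z t (u t) := by
      intro a b
      rw [hux b, hux a, add_sub_add_left_eq_sub,
        intervalIntegral.integral_interval_sub_left (hi _ _) (hi _ _)]
    have hder : ∀ x, HasDerivAt (fun x => (u x).1) (u x).2 x := by
      intro x
      have e : (fun x => (u x).1) = fun x => (u 1).1 + ∫ t in (1 : ℝ)..x, (u t).2 := by
        funext x
        have := congrArg Prod.fst (hdiff 1 x)
        rw [fst_integral (hi _ _)] at this
        simp only [rhs, Prod.fst_sub] at this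
        rw [← this]; ring
      rw [e]
      exact (intervalIntegral.integral_hasDerivAt_right
        ((continuous_snd.comp hu).intervalIntegrable _ _)
        ((continuous_snd.comp hu).stronglyMeasurableAtFilter _ _)
        (continuous_snd.comp hu).continuousAt).const_add _
    have hderiv : deriv (fun x => (u x).1) = fun x => (u x).2 := funext fun x => (hder x).deriv
    refine ⟨fun x => (u x).1, ⟨?_, ?_⟩, ?_⟩
    · rw [contDiff_one_iff_deriv]
      refine ⟨fun x => (hder x).differentiableAt, ?_⟩
      rw [hderiv]
      exact continuous_snd.comp hu
    · intro a b
      rw [hderiv]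
      have := congrArg Prod.snd (hdiff a b)
      rw [snd_integral (hi _ _)] at this
      simpa [rhs] using this
    · intro x hx
      let v : ℝ → ℂ × ℂ := fun x => (Complex.exp (Complex.I * z * x),
        Complex.I * z * Complex.exp (Complex.I * z * x))
      have hv : Continuous v := by fun_prop
      have hve : ∀ x : ℝ, HasDerivAt (fun x : ℝ => Complex.exp (Complex.I * z * x))
          (Complex.I * z * Complex.exp (Complex.I * z * x)) x := by
        intro x
        have h1 : HasDerivAt (fun x : ℝ => Complex.I * z * (x : ℂ)) (Complex.I * z * 1) x :=
          (Complex.ofRealCLM.hasDerivAt (x := x)).const_mul (Complex.I * z)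
        simpa [mul_comm] using h1.cexp
      have huv : u x = v x := by
        apply system_unique hqi z hu hv (x₀ := 1)
        intro y hy
        rw [uIcc_of_le hx] at hy
        have hvi : v y - v 1 = ∫ t in (1 : ℝ)..y, rhs q z t (v t) := by
          have hq0 : ∀ᵐ t : ℝ, t ∈ uIoc 1 y → rhs q z t (v t) = rhs (fun _ => 0) z t (v t) := by
            filter_upwards [hqs] with t ht ht'
            rw [uIoc_of_le hy.1] at ht'
            have : q t = 0 := ht (fun h => absurd h.2 (not_le.2 ht'.1))
            simp [rhs, this]
          rw [intervalIntegral.integral_congr_ae hq0]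
          symm
          apply intervalIntegral.integral_eq_sub_of_hasDerivAt
          · intro t _
            have h2 := (hve t).prodMk ((hve t).const_mul (Complex.I * z))
            have e : ((Complex.I * z * Complex.exp (Complex.I * z * t),
                Complex.I * z * (Complex.I * z * Complex.exp (Complex.I * z * t))) : ℂ × ℂ) =
                rhs (fun _ => 0) z t (v t) := by
              simp only [rhs, v, Prod.mk.injEq, true_and]
              push_cast
              linear_combination (z ^ 2 * Complex.exp (Complex.I * z * t)) * Complex.I_sq
            exact h2.congr_deriv e
          · exact rhs_integrable (integrable_zero _ _ _) z hv _ _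
        have hv1 : v 1 = u 1 := by
          have := hux 1
          rw [intervalIntegral.integral_same, add_zero] at this
          rw [this]; simp [v]
        simp only [rhs_sub]
        rw [intervalIntegral.integral_sub (hi _ _) (rhs_integrable hqi z hv _ _), ← hdiff, ← hvi,
          hv1]
        abel
      exact congrArg Prod.fst huv
  · intro y₁ y₂ h₁ h₂
    funext x
    have hc : ∀ {y}, IsJostPlus q z y → Continuous fun t => ((y t, deriv y t) : ℂ × ℂ) :=
      fun h => h.1.1.continuous.prodMk (h.1.1.continuous_deriv le_rfl)
    have hev : y₁ =ᶠ[𝓝 2] y₂ := by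
      filter_upwards [Ioi_mem_nhds (by norm_num : (1 : ℝ) < 2)] with t ht
      rw [h₁.2 t (le_of_lt ht), h₂.2 t (le_of_lt ht)]
    have := system_unique hqi z (x₀ := 2) (x := x) (hc h₁) (hc h₂) (by
      intro y _
      simp only [rhs_sub]
      rw [intervalIntegral.integral_sub (rhs_integrable hqi z (hc h₁) _ _)
        (rhs_integrable hqi z (hc h₂) _ _), ← system_of_solution hqi h₁.1,
        ← system_of_solution hqi h₂.1, hev.eq_of_nhds, hev.deriv_eq]
      abel)
    exact congrArg Prod.fst this

/-- Reflection `x ↦ -x` turns solutions for `q` into solutions for the reflected potential. -/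
lemma IsSchrodingerSolution.reflect {q : ℝ → ℝ} {z : ℂ} {y : ℝ → ℂ}
    (hy : IsSchrodingerSolution q z y) :
    IsSchrodingerSolution (fun x => q (-x)) z (fun x => y (-x)) := by
  refine ⟨hy.1.comp contDiff_neg, fun a b => ?_⟩
  rw [deriv_comp_neg, deriv_comp_neg]
  have h1 := intervalIntegral.integral_comp_neg (a := a) (b := b)
    (fun t => ((q t : ℂ) - z ^ 2) * y t)
  rw [h1, ← hy.2]
  ring

lemma isJostMinus_iff {q : ℝ → ℝ} {z : ℂ} {y : ℝ → ℂ} :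
    IsJostMinus q z y ↔ IsJostPlus (fun x => q (-x)) z (fun x => y (-x)) := by
  constructor
  · rintro ⟨h1, h2⟩
    refine ⟨h1.reflect, fun x hx => ?_⟩
    show y (-x) = _
    rw [h2 (-x) (by linarith)]
    congr 1; push_cast; ring
  · rintro ⟨h1, h2⟩
    refine ⟨by simpa using h1.reflect, fun x hx => ?_⟩
    have : y (- -x) = _ := h2 (-x) (by linarith)
    rw [neg_neg] at this
    rw [this]
    congr 1; push_cast; ring

/-- The Jost solution `f⁻(·, z)` exists and is unique. -/
theorem existsUnique_isJostMinus {q : ℝ → ℝ} (hq : IsPotential q) (z : ℂ) :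
    ∃! y : ℝ → ℂ, IsJostMinus q z y := by
  have hq' : IsPotential (fun x => q (-x)) := by
    refine ⟨hq.1.comp_neg, ?_⟩
    filter_upwards [(Measure.measurePreserving_neg (volume : Measure ℝ)).quasiMeasurePreserving.ae
      hq.2] with x hx hx'
    apply hx
    intro h
    exact hx' ⟨by linarith [h.2], by linarith [h.1]⟩
  obtain ⟨y, hy, hu⟩ := existsUnique_isJostPlus hq' z
  refine ⟨fun x => y (-x), isJostMinus_iff.2 (by simpa using hy), fun v hv => ?_⟩
  have := hu _ (isJostMinus_iff.1 hv)
  funext x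
  have h2 := congrFun this (-x)
  simpa using h2

/-- The Jost solution `f⁺(·, z)` of a potential supported in `[-1, 1]`. -/
def jostPlus (q : ℝ → ℝ) (z : ℂ) : ℝ → ℂ := Classical.epsilon (IsJostPlus q z)

/-- The Jost solution `f⁻(·, z)` of a potential supported in `[-1, 1]`. -/
def jostMinus (q : ℝ → ℝ) (z : ℂ) : ℝ → ℂ := Classical.epsilon (IsJostMinus q z)

theorem isJostPlus_jostPlus {q : ℝ → ℝ} (hq : IsPotential q) (z : ℂ) :
    IsJostPlus q z (jostPlus q z) :=
  Classical.epsilon_spec (existsUnique_isJostPlus hq z).exists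

theorem isJostMinus_jostMinus {q : ℝ → ℝ} (hq : IsPotential q) (z : ℂ) :
    IsJostMinus q z (jostMinus q z) :=
  Classical.epsilon_spec (existsUnique_isJostMinus hq z).exists

/-- The Wronskian `[f, g] = f g' - f' g`, at the point `x`. -/
def wronskian (f g : ℝ → ℂ) (x : ℝ) : ℂ := f x * deriv g x - deriv f x * g x

/-- The function `s = s⁻`, `s(z) = [f⁺(·, z), f⁻(·, -z)]`. Both functions solve the same equation,
so their Wronskian does not depend on the point; it is taken at `x = -1`. -/
def sFun (q : ℝ → ℝ) (z : ℂ) : ℂ := wronskian (jostPlus q z) (jostMinus q (-z)) (-1)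

/-- The class `B_δ(Q)`: potentials with `‖q‖₁ ≤ Q` and `δ ≤ |s(0)|`. (At `z = 0` the Wronskian `w`
of `f⁻` and `f⁺` is `-s`, so the last condition is also `δ ≤ |w(0)|`.) -/
def potentialClass (δ Q : ℝ) : Set (ℝ → ℝ) :=
  {q | IsPotential q ∧ ∫ x, |q x| ≤ Q ∧ δ ≤ ‖sFun q 0‖}

/-- `a 0, …, a (N - 1)` lists the zeros of `f` in the open disk of radius `R` about `0`, each
as often as its multiplicity. -/
def ListsZeros (f : ℂ → ℂ) (R : ℝ) {N : ℕ} (a : Fin N → ℂ) : Prop :=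
  (∀ n, a n ∈ Metric.ball (0 : ℂ) R) ∧
    ∀ z ∈ Metric.ball (0 : ℂ) R, ((Nat.card {n : Fin N // a n = z} : ℕ) : ℕ∞) = analyticOrderAt f z

end

open Set MeasureTheory Filter Topology

noncomputable section

/-! The function `s` is entire of exponential type and bounded on the real line, so it is almost
determined near `0` by `s 0`, `s' 0 / s 0` and its zeros in a large disk.

Control of `s` comes from the Jost solution. Variation of constants and Gronwall's inequality bound
`f⁺` on `[-1, 1]` (`IsJostPlus.bound`), and writing `s` as an integral of `q f⁺` against an
exponential gives `‖s z‖ ≤ Q exp (2Q) exp (4 |Im z|)` (`norm_sFun_le`). Holomorphy is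
`differentiable_sFun`.

Divide `s` by `s 0 ∏ (1 - z / a n)`, the product running over the zeros in `|z| < R`. On `|z| = 2R`
every factor has modulus at least `1`, so the quotient is at most exponentially large in `R`,
whatever the number of zeros. It has no zeros in the disk, so it is `exp h` with `Re h = O(R)`.
Borel–Carathéodory and the Schwarz lemma then make `h` linear up to an error `O(|z|² / R)`, and the
logarithmic derivative at `0` identifies the linear coefficient (`exists_truncated_hadamard`). For
`|z| ≤ R^(1/3)` the error is `O(R^(-1/3))`.

Two such factorizations with the same `s' 0 / s 0` are compared through their quotient, a product of
factors each within `exp X - 1` of `1`; the exponents add up to the bracket of the theorem, up to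
constants (`norm_sub_le_of_products`). Multiplying by the bound for `s` on the real line gives the
estimate. The zeros stay away from `0` by `le_norm_of_zero`. -/

/-! ### Calculus with primitives of integrable functions, and Gronwall's inequality. -/

/-- The primitive of an integrable function is absolutely continuous. -/
lemma absolutelyContinuousOnInterval_primitive {E : Type*} [NormedAddCommGroup E]
    [NormedSpace ℝ E] {f : ℝ → E} {a b c : ℝ} (hf : ∀ a b, IntervalIntegrable f volume a b) :
    AbsolutelyContinuousOnInterval (fun x => ∫ t in c..x, f t) a b := by
  -- Increments of the primitive of `f` are dominated by those of the primitive of `‖f‖`, so the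
  -- same `δ` serves.
  have h := ((hf a b).norm).absolutelyContinuousOnInterval_intervalIntegral
    (c := a) left_mem_uIcc
  rw [absolutelyContinuousOnInterval_iff] at h ⊢
  intro ε hε
  obtain ⟨δ, hδ, H⟩ := h ε hε
  refine ⟨δ, hδ, fun I hI hI' => lt_of_le_of_lt (Finset.sum_le_sum fun i _ => ?_) (H I hI hI')⟩
  rw [dist_comm, dist_eq_norm, dist_comm, dist_eq_norm,
    intervalIntegral.integral_interval_sub_left (hf _ _) (hf _ _),
    intervalIntegral.integral_interval_sub_left (hf _ _).norm (hf _ _).norm]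
  exact intervalIntegral.norm_integral_le_abs_integral_norm

/-- The fundamental theorem of calculus for absolutely continuous functions. -/
lemma AbsolutelyContinuousOnInterval.sub_eq_integral_of_ae_hasDerivAt {E : Type*}
    [NormedAddCommGroup E] [NormedSpace ℝ E] [CompleteSpace E] {F f : ℝ → E} {a b : ℝ}
    (hF : AbsolutelyContinuousOnInterval F a b) (hf : ∀ a b, IntervalIntegrable f volume a b)
    (hd : ∀ᵐ x, HasDerivAt F (f x) x) : F b - F a = ∫ t in a..b, f t := by
  -- `F` minus the primitive of `f` is absolutely continuous with derivative zero almost everywhere,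
  -- hence constant.
  have hac := hF.sub (absolutelyContinuousOnInterval_primitive (c := a) hf)
  obtain ⟨C, hC⟩ := hac.const_of_ae_hasDerivAt_zero (by
    filter_upwards [hd, (hf a b).ae_hasDerivAt_integral] with x hx hx' hxu
    simpa using hx.sub (hx' hxu a left_mem_uIcc))
  have h1 := hC a left_mem_uIcc
  have h2 := hC b right_mem_uIcc
  simp only [Pi.sub_apply, intervalIntegral.integral_same, sub_zero] at h1 h2
  rw [← sub_eq_zero, ← sub_eq_zero.2 (h2.trans h1.symm)]
  abel

lemma ae_hasDerivAt_primitive {E : Type*} [NormedAddCommGroup E] [NormedSpace ℝ E]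
    [CompleteSpace E] {f : ℝ → E} (hf : ∀ a b, IntervalIntegrable f volume a b) (c : ℝ) :
    ∀ᵐ x, HasDerivAt (fun x => ∫ t in c..x, f t) (f x) x := by
  have hl : LocallyIntegrable f volume := by
    intro x
    refine ⟨Ioc (x - 1) (x + 1), Ioc_mem_nhds (by linarith) (by linarith), ?_⟩
    exact (hf (x - 1) (x + 1)).1
  filter_upwards [LocallyIntegrable.ae_hasDerivAt_integral hl] with x hx using hx c

/-- The product rule for primitives of integrable functions. -/
lemma mul_sub_mul_eq_integral {h Y u v : ℝ → ℂ}
    (hu : ∀ a b, IntervalIntegrable u volume a b) (hv : ∀ a b, IntervalIntegrable v volume a b)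
    (hh : ∀ a b, h b - h a = ∫ t in a..b, u t) (hY : ∀ a b, Y b - Y a = ∫ t in a..b, v t)
    (a b : ℝ) : h b * Y b - h a * Y a = ∫ t in a..b, (u t * Y t + h t * v t) := by
  have eh : h = fun x => h 0 + ∫ t in (0 : ℝ)..x, u t := funext fun x => by rw [← hh]; ring
  have eY : Y = fun x => Y 0 + ∫ t in (0 : ℝ)..x, v t := funext fun x => by rw [← hY]; ring
  have hhc : Continuous h := by
    rw [eh]; exact continuous_const.add (intervalIntegral.continuous_primitive hu 0)
  have hYc : Continuous Y := by
    rw [eY]; exact continuous_const.add (intervalIntegral.continuous_primitive hv 0)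
  have hac : ∀ {g w : ℝ → ℂ}, (∀ a b, IntervalIntegrable w volume a b) →
      g = (fun x => g 0 + ∫ t in (0 : ℝ)..x, w t) → AbsolutelyContinuousOnInterval g a b := by
    intro g w hw e
    rw [e]
    exact (contDiff_const.contDiffOn.absolutelyContinuousOnInterval).add
      (absolutelyContinuousOnInterval_primitive hw)
  have hd : ∀ {g w : ℝ → ℂ}, (∀ a b, IntervalIntegrable w volume a b) →
      g = (fun x => g 0 + ∫ t in (0 : ℝ)..x, w t) → ∀ᵐ x, HasDerivAt g (w x) x := by
    intro g w hw e
    rw [e]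
    filter_upwards [ae_hasDerivAt_primitive hw 0] with x hx using hx.const_add _
  have := AbsolutelyContinuousOnInterval.sub_eq_integral_of_ae_hasDerivAt
    (F := h • Y) (f := fun t => u t * Y t + h t * v t) ((hac hu eh).smul (hac hv eY))
    (fun a b => ((hu a b).mul_continuousOn hYc.continuousOn).add
      ((hv a b).continuousOn_mul hhc.continuousOn)) (by
    filter_upwards [hd hu eh, hd hv eY] with x h1 h2 using h1.mul h2)
  simpa using this

/-- Gronwall's inequality with an integrable kernel, integrating from the right end point. -/
lemma gronwall_integrable {p F : ℝ → ℝ} (hp : Integrable p) (hp0 : ∀ t, 0 ≤ p t)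
    (hF : Continuous F) {A b c : ℝ}
    (h : ∀ x ∈ Icc c b, F x ≤ A + ∫ t in x..b, p t * F t) :
    ∀ x ∈ Icc c b, F x ≤ A * Real.exp (∫ t in x..b, p t) := by
  intro x hx
  have hpi : ∀ a b, IntervalIntegrable p volume a b := fun a b => hp.intervalIntegrable
  have hpF : ∀ a b, IntervalIntegrable (fun t => p t * F t) volume a b := fun a b =>
    (hpi a b).mul_continuousOn hF.continuousOn
  -- `H` is the right-hand side of the hypothesis, so `F ≤ H` and `(exp P * H)' = exp P * p * (H -
  -- F) ≥ 0` almost everywhere. Comparing `x` with `b`, where `P = 0` and `H = A`, gives the claim.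
  set P : ℝ → ℝ := fun x => ∫ t in b..x, p t with hP
  set H : ℝ → ℝ := fun x => A - ∫ t in b..x, p t * F t with hH
  have hPc : Continuous P := intervalIntegral.continuous_primitive hpi b
  have hHc : Continuous H := continuous_const.sub (intervalIntegral.continuous_primitive hpF b)
  have hPd : ∀ᵐ x, HasDerivAt P (p x) x := ae_hasDerivAt_primitive hpi b
  have hHd : ∀ᵐ x, HasDerivAt H (-(p x * F x)) x := by
    filter_upwards [ae_hasDerivAt_primitive hpF b] with x hx using hx.const_sub _
  have hPac : AbsolutelyContinuousOnInterval P x b := absolutelyContinuousOnInterval_primitive hpi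
  -- `P` is bounded on the interval and `exp` is Lipschitz on bounded sets.
  have hEac : AbsolutelyContinuousOnInterval (fun t => Real.exp (P t)) x b := by
    obtain ⟨B, hB⟩ := hPac.exists_bound
    have hlip : ∀ s ∈ uIcc x b, ∀ t ∈ uIcc x b,
        dist (Real.exp (P s)) (Real.exp (P t)) ≤ Real.exp B * dist (P s) (P t) := by
      intro s hs t ht
      have := Convex.norm_image_sub_le_of_norm_deriv_le (f := Real.exp) (C := Real.exp B)
        (s := Icc (-B) B) (fun y _ => Real.differentiableAt_exp)
        (fun y hy => by
          rw [Real.deriv_exp, Real.norm_eq_abs, Real.abs_exp]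
          exact Real.exp_le_exp.2 hy.2) (convex_Icc _ _)
        (abs_le.1 (hB t ht)) (abs_le.1 (hB s hs))
      simpa [dist_eq_norm] using this
    rw [absolutelyContinuousOnInterval_iff] at hPac ⊢
    intro ε hε
    obtain ⟨δ, hδ, H⟩ := hPac (ε / Real.exp B) (by positivity)
    refine ⟨δ, hδ, fun I hI hI' => ?_⟩
    have h1 := H I hI hI'
    rw [lt_div_iff₀ (Real.exp_pos _), mul_comm, Finset.mul_sum] at h1
    refine lt_of_le_of_lt (Finset.sum_le_sum fun i hi => ?_) h1
    have h2 := hI.1 i hi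
    exact hlip _ h2.1 _ h2.2
  have hHac : AbsolutelyContinuousOnInterval H x b :=
    (contDiff_const.contDiffOn.absolutelyContinuousOnInterval).sub
      (absolutelyContinuousOnInterval_primitive hpF)
  have hint : ∀ a b, IntervalIntegrable
      (fun t => Real.exp (P t) * p t * H t + Real.exp (P t) * (-(p t * F t))) volume a b :=
    fun a b => (((hpi a b).continuousOn_mul (Real.continuous_exp.comp hPc).continuousOn).mul_continuousOn
      hHc.continuousOn).add ((hpF a b).neg.continuousOn_mul (Real.continuous_exp.comp hPc).continuousOn)
  have key := AbsolutelyContinuousOnInterval.sub_eq_integral_of_ae_hasDerivAt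
    (hEac.mul hHac) hint (by
      filter_upwards [hPd, hHd] with t h1 h2 using h1.exp.mul h2)
  have hFH : ∀ t ∈ Icc c b, F t ≤ H t := by
    intro t ht
    simp only [hH]
    rw [intervalIntegral.integral_symm]
    simpa using h t ht
  have hnn : 0 ≤ ∫ t in x..b,
      (Real.exp (P t) * p t * H t + Real.exp (P t) * (-(p t * F t))) := by
    apply intervalIntegral.integral_nonneg hx.2
    intro t ht
    have h1 := hFH t ⟨hx.1.trans ht.1, ht.2⟩
    have h2 : 0 ≤ Real.exp (P t) * p t := mul_nonneg (Real.exp_pos _).le (hp0 t)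
    nlinarith
  rw [← key] at hnn
  have hPx : P x = -∫ t in x..b, p t := intervalIntegral.integral_symm _ _
  simp only [Pi.mul_apply, hPx] at hnn
  have hb : P b = 0 := intervalIntegral.integral_same
  have hHb : H b = A := by simp [hH]
  rw [hb, hHb, Real.exp_zero, one_mul, Real.exp_neg, sub_nonneg,
    inv_mul_le_iff₀ (Real.exp_pos _)] at hnn
  rw [mul_comm]
  exact (hFH x hx).trans hnn

/-! ### The free equation, variation of constants and Volterra bounds. -/

/-- The solution `sin (z t) / z` of `-y'' = z² y` with `y(0) = 0`, `y'(0) = 1`. -/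
def freeSine (z : ℂ) (t : ℝ) : ℂ := if z = 0 then (t : ℂ) else Complex.sin (z * t) / z

@[simp] lemma freeSine_zero (z : ℂ) : freeSine z 0 = 0 := by simp [freeSine]

lemma mul_freeSine (z : ℂ) (t : ℝ) : z * freeSine z t = Complex.sin (z * t) := by
  by_cases h : z = 0
  · simp [h]
  · simp only [freeSine, h, if_false]; field_simp

lemma hasDerivAt_const_mul_ofReal (z : ℂ) (t : ℝ) :
    HasDerivAt (fun t : ℝ => z * (t : ℂ)) z t := by
  simpa using (Complex.ofRealCLM.hasDerivAt (x := t)).const_mul z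

lemma hasDerivAt_freeSine (z : ℂ) (t : ℝ) :
    HasDerivAt (freeSine z) (Complex.cos (z * t)) t := by
  by_cases h : z = 0
  · have e : freeSine z = fun t : ℝ => (1 : ℂ) * t := by funext t; simp [freeSine, h]
    rw [e, h]
    simpa using hasDerivAt_const_mul_ofReal 1 t
  · have e : freeSine z = fun t : ℝ => Complex.sin (z * t) / z := by
      funext t; simp [freeSine, h]
    rw [e]
    refine (((Complex.hasDerivAt_sin _).comp t (hasDerivAt_const_mul_ofReal z t)).div_const z).congr_deriv ?_
    field_simp

lemma hasDerivAt_cos_mul (z : ℂ) (t : ℝ) :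
    HasDerivAt (fun t : ℝ => Complex.cos (z * t)) (-z ^ 2 * freeSine z t) t := by
  refine ((Complex.hasDerivAt_cos _).comp t (hasDerivAt_const_mul_ofReal z t)).congr_deriv ?_
  rw [← mul_freeSine]; ring

lemma continuous_freeSine (z : ℂ) : Continuous (freeSine z) :=
  continuous_iff_continuousAt.2 fun t => (hasDerivAt_freeSine z t).continuousAt

lemma norm_exp_I_mul_le (w : ℂ) : ‖Complex.exp (Complex.I * w)‖ ≤ Real.exp |w.im| := by
  rw [Complex.norm_exp]
  apply Real.exp_le_exp.2
  simpa using neg_le_abs w.im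

lemma norm_cos_le_exp (w : ℂ) : ‖Complex.cos w‖ ≤ Real.exp |w.im| := by
  have h1 := norm_exp_I_mul_le w
  have h2 := norm_exp_I_mul_le (-w)
  rw [Complex.neg_im, abs_neg] at h2
  have : Complex.cos w = (Complex.exp (Complex.I * w) + Complex.exp (Complex.I * -w)) / 2 := by
    rw [Complex.cos]; ring_nf
  rw [this, norm_div, Complex.norm_ofNat]
  have := norm_add_le (Complex.exp (Complex.I * w)) (Complex.exp (Complex.I * -w))
  linarith

lemma norm_cos_mul_le (z : ℂ) (t : ℝ) :
    ‖Complex.cos (z * t)‖ ≤ Real.exp (|z.im| * |t|) := by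
  simpa [abs_mul] using norm_cos_le_exp (z * t)

/-- The mean value inequality applied to the derivative `cos (z t)` avoids dividing by `z`, so the
bound is uniform down to `z = 0`. -/
lemma norm_freeSine_le (z : ℂ) (t : ℝ) :
    ‖freeSine z t‖ ≤ Real.exp (|z.im| * |t|) * |t| := by
  have := Convex.norm_image_sub_le_of_norm_hasDerivWithin_le (f := freeSine z)
    (f' := fun t => Complex.cos (z * t)) (s := uIcc 0 t) (C := Real.exp (|z.im| * |t|))
    (fun s _ => (hasDerivAt_freeSine z s).hasDerivWithinAt) (fun s hs => by
      refine (norm_cos_mul_le z s).trans (Real.exp_le_exp.2 ?_)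
      have : |s - 0| ≤ |t - 0| := abs_sub_left_of_mem_uIcc hs
      simp only [sub_zero] at this
      gcongr) (convex_uIcc _ _) left_mem_uIcc right_mem_uIcc
  simpa using this

/-- Variation of constants for `-d'' + g = w² d`. -/
lemma variation_of_constants {d d' g : ℝ → ℂ} {w : ℂ} (hd : ∀ x, HasDerivAt d (d' x) x)
    (hc : Continuous d') (hg : ∀ a b, IntervalIntegrable g volume a b)
    (h : ∀ a b, d' b - d' a = ∫ t in a..b, (g t - w ^ 2 * d t)) (x b : ℝ) :
    d x = Complex.cos (w * ((b - x : ℝ) : ℂ)) * d b - freeSine w (b - x) * d' b +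
      ∫ t in x..b, freeSine w (t - x) * g t := by
  have hdc : Continuous d := continuous_iff_continuousAt.2 fun t => (hd t).continuousAt
  have hSd : ∀ t, HasDerivAt (fun t => freeSine w (t - x))
      (Complex.cos (w * ((t - x : ℝ) : ℂ))) t := fun t =>
    HasDerivAt.comp_sub_const t x (hasDerivAt_freeSine w (t - x))
  have hCd : ∀ t, HasDerivAt (fun t => Complex.cos (w * ((t - x : ℝ) : ℂ)))
      (-w ^ 2 * freeSine w (t - x)) t := fun t =>
    HasDerivAt.comp_sub_const (f := fun t : ℝ => Complex.cos (w * (t : ℂ))) t x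
      (hasDerivAt_cos_mul w (t - x))
  have hSc : Continuous fun t => freeSine w (t - x) :=
    (continuous_freeSine w).comp (continuous_id.sub continuous_const)
  have hCc : Continuous fun t : ℝ => Complex.cos (w * ((t - x : ℝ) : ℂ)) := by fun_prop
  have hSc' : Continuous fun t => -w ^ 2 * freeSine w (t - x) := continuous_const.mul hSc
  have ftc : ∀ {f f' : ℝ → ℂ}, (∀ t, HasDerivAt f (f' t) t) → Continuous f' →
      ∀ a b, f b - f a = ∫ t in a..b, f' t := fun hf hf' a b =>
    (intervalIntegral.integral_eq_sub_of_hasDerivAt (fun t _ => hf t)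
      (hf'.intervalIntegrable _ _)).symm
  have hgd : ∀ a b, IntervalIntegrable (fun t => g t - w ^ 2 * d t) volume a b := fun a b =>
    (hg a b).sub ((hdc.const_mul _).intervalIntegrable _ _)
  -- With `S t = freeSine w (t - x)`, the derivative of `S d' - S' d` is `S g`, because the `w²`
  -- terms cancel. At `t = x` one has `S = 0` and `S' = 1`, which isolates `d x`.
  have e1 := mul_sub_mul_eq_integral (fun a b => hCc.intervalIntegrable a b) hgd
    (ftc hSd hCc) h x b
  have e2 := mul_sub_mul_eq_integral (fun a b => hSc'.intervalIntegrable a b)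
    (fun a b => hc.intervalIntegrable a b) (ftc hCd hSc') (ftc hd hc) x b
  have i1 : IntervalIntegrable (fun t => Complex.cos (w * ((t - x : ℝ) : ℂ)) * d' t +
      freeSine w (t - x) * (g t - w ^ 2 * d t)) volume x b :=
    ((hCc.mul hc).intervalIntegrable _ _).add ((hgd x b).continuousOn_mul hSc.continuousOn)
  have i2 : IntervalIntegrable (fun t => -w ^ 2 * freeSine w (t - x) * d t +
      Complex.cos (w * ((t - x : ℝ) : ℂ)) * d' t) volume x b :=
    ((hSc'.mul hdc).add (hCc.mul hc)).intervalIntegrable _ _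
  have e3 := congrArg₂ (· - ·) e1 e2
  simp only [← intervalIntegral.integral_sub i1 i2] at e3
  have e4 : ∫ t in x..b, freeSine w (t - x) * g t = ∫ t in x..b,
      (Complex.cos (w * ((t - x : ℝ) : ℂ)) * d' t +
      freeSine w (t - x) * (g t - w ^ 2 * d t) - (-w ^ 2 * freeSine w (t - x) * d t +
      Complex.cos (w * ((t - x : ℝ) : ℂ)) * d' t)) := by
    congr 1; funext t; ring
  rw [e4, ← e3]
  simp only [sub_self, freeSine_zero, Complex.ofReal_zero, mul_zero, Complex.cos_zero]
  ring

lemma integral_abs_le_of_integrable {q : ℝ → ℝ} (hq : Integrable q) {a b : ℝ} (hab : a ≤ b) :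
    ∫ t in a..b, |q t| ≤ ∫ t, |q t| := by
  rw [intervalIntegral.integral_of_le hab]
  exact setIntegral_le_integral hq.abs (Eventually.of_forall fun t => abs_nonneg _)

/-- A bound for Volterra equations with kernel `freeSine w (t - x) * q t` on `[-1, 1]`. -/
lemma volterra_bound {q : ℝ → ℝ} (hq : Integrable q) {w : ℂ} {d α : ℝ → ℂ} (hd : Continuous d)
    {A Q : ℝ} (hA : 0 ≤ A) (hQ : ∫ t, |q t| ≤ Q)
    (h : ∀ x ∈ Icc (-1 : ℝ) 1, d x = α x + ∫ t in x..1, freeSine w (t - x) * (q t * d t))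
    (hα : ∀ x ∈ Icc (-1 : ℝ) 1, Real.exp (|w.im| * x) * ‖α x‖ ≤ A) :
    ∀ x ∈ Icc (-1 : ℝ) 1, Real.exp (|w.im| * x) * ‖d x‖ ≤ A * Real.exp (2 * Q) := by
  intro x hx
  set β := |w.im| with hβ
  -- The weight absorbs the growth `exp (β (t - x))` of the kernel and leaves the Gronwall kernel `2
  -- |q t|`; the `2` bounds `t - x` on `[-1, 1]`.
  set F : ℝ → ℝ := fun x => Real.exp (β * x) * ‖d x‖ with hF
  have hFc : Continuous F := by fun_prop
  have hp : Integrable fun t => 2 * |q t| := hq.abs.const_mul 2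
  have hpF : ∀ a b, IntervalIntegrable (fun t => 2 * |q t| * F t) volume a b := fun a b =>
    hp.intervalIntegrable.mul_continuousOn hFc.continuousOn
  have key := gronwall_integrable hp (fun t => by positivity) hFc (A := A) (b := 1) (c := -1) (by
    intro x hx
    have h1 : ‖∫ t in x..1, freeSine w (t - x) * (q t * d t)‖ ≤
        ∫ t in x..1, Real.exp (-(β * x)) * (2 * |q t| * F t) := by
      refine intervalIntegral.norm_integral_le_of_norm_le hx.2
        (Eventually.of_forall fun t ht => ?_) ((hpF x 1).const_mul _)
      have h0 : 0 ≤ t - x := by linarith [ht.1]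
      have h2 := norm_freeSine_le w (t - x)
      rw [abs_of_nonneg h0] at h2
      have h3 : ‖freeSine w (t - x)‖ ≤ Real.exp (β * (t - x)) * 2 :=
        h2.trans (by gcongr; linarith [ht.2, hx.1])
      rw [norm_mul, norm_mul, Complex.norm_real, Real.norm_eq_abs]
      calc _ ≤ Real.exp (β * (t - x)) * 2 * (|q t| * ‖d t‖) := by gcongr
        _ = Real.exp (-(β * x) + β * t) * 2 * (|q t| * ‖d t‖) := by ring_nf
        _ = _ := by rw [Real.exp_add, hF]; ring
    rw [intervalIntegral.integral_const_mul] at h1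
    calc F x = Real.exp (β * x) * ‖α x + ∫ t in x..1, freeSine w (t - x) * (q t * d t)‖ := by
          rw [← h x hx]
      _ ≤ Real.exp (β * x) * (‖α x‖ +
          Real.exp (-(β * x)) * ∫ t in x..1, 2 * |q t| * F t) := by
          gcongr; exact (norm_add_le _ _).trans (by gcongr)
      _ = Real.exp (β * x) * ‖α x‖ + (Real.exp (β * x) * Real.exp (-(β * x))) *
          ∫ t in x..1, 2 * |q t| * F t := by ring
      _ ≤ A + ∫ t in x..1, 2 * |q t| * F t := by
          rw [← Real.exp_add, add_neg_cancel, Real.exp_zero, one_mul]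
          gcongr; exact hα x hx) x hx
  refine key.trans ?_
  gcongr
  rw [intervalIntegral.integral_const_mul]
  gcongr
  exact (integral_abs_le_of_integrable hq hx.2).trans hQ

/-! ### Bounds for the Jost solution and for `s`. -/

lemma IsSchrodingerSolution.hasDerivAt {q : ℝ → ℝ} {z : ℂ} {y : ℝ → ℂ}
    (hy : IsSchrodingerSolution q z y) (x : ℝ) : HasDerivAt y (deriv y x) x :=
  ((hy.1.differentiable one_ne_zero) x).hasDerivAt

lemma IsSchrodingerSolution.continuous_deriv {q : ℝ → ℝ} {z : ℂ} {y : ℝ → ℂ}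
    (hy : IsSchrodingerSolution q z y) : Continuous (deriv y) :=
  hy.1.continuous_deriv le_rfl

lemma intervalIntegrable_potential_mul {q : ℝ → ℝ} (hq : Integrable q) {y : ℝ → ℂ}
    (hy : Continuous y) (a b : ℝ) :
    IntervalIntegrable (fun t => (q t : ℂ) * y t) volume a b :=
  (hq.ofReal.intervalIntegrable).mul_continuousOn hy.continuousOn

lemma IsSchrodingerSolution.deriv_sub_deriv {q : ℝ → ℝ} {z : ℂ} {y : ℝ → ℂ}
    (hy : IsSchrodingerSolution q z y) (a b : ℝ) :
    deriv y b - deriv y a = ∫ t in a..b, ((q t : ℂ) * y t - z ^ 2 * y t) := by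
  rw [hy.2]; congr 1; funext t; ring

lemma hasDerivAt_exp_mul (c : ℂ) (x : ℝ) :
    HasDerivAt (fun x : ℝ => Complex.exp (c * x)) (c * Complex.exp (c * x)) x := by
  simpa [mul_comm] using (hasDerivAt_const_mul_ofReal c x).cexp

/-- The explicit formula is available on `[1, ∞)` only, but `y` is differentiable at `1`, so the
one-sided derivative suffices. -/
lemma IsJostPlus.deriv_one {q : ℝ → ℝ} {z : ℂ} {y : ℝ → ℂ} (hy : IsJostPlus q z y) :
    deriv y 1 = Complex.I * z * Complex.exp (Complex.I * z) := by
  have h1 := (hy.1.hasDerivAt 1).hasDerivWithinAt (s := Ici 1)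
  have h2 := (hasDerivAt_exp_mul (Complex.I * z) 1).hasDerivWithinAt (s := Ici 1)
  have h3 := h2.congr (f₁ := y) (fun x hx => hy.2 x hx) (hy.2 1 le_rfl)
  simpa using (uniqueDiffWithinAt_Ici 1).eq_deriv _ h1 h3

lemma IsJostMinus.deriv_neg_one {q : ℝ → ℝ} {z : ℂ} {y : ℝ → ℂ} (hy : IsJostMinus q z y) :
    deriv y (-1) = -(Complex.I * z) * Complex.exp (Complex.I * z) := by
  have h1 := (hy.1.hasDerivAt (-1)).hasDerivWithinAt (s := Iic (-1))
  have h2 := (hasDerivAt_exp_mul (-(Complex.I * z)) (-1)).hasDerivWithinAt (s := Iic (-1))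
  have h3 := h2.congr (f₁ := y) (fun x hx => by rw [hy.2 x hx, neg_mul])
    (by rw [hy.2 (-1) le_rfl, neg_mul])
  simpa using (uniqueDiffWithinAt_Iic (-1)).eq_deriv _ h1 h3

/-- With data at `1`, the free part of the Volterra equation is `exp (i z x)`. Its weighted norm is
at most `exp (2 |Im z|)`, and removing the weight at the end costs one more `exp |Im z|`. -/
lemma IsJostPlus.bound {q : ℝ → ℝ} (hq : Integrable q) {z : ℂ} {y : ℝ → ℂ}
    (hy : IsJostPlus q z y) {Q : ℝ} (hQ : ∫ t, |q t| ≤ Q) :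
    ∀ x ∈ Icc (-1 : ℝ) 1, ‖y x‖ ≤ Real.exp (3 * |z.im| + 2 * Q) := by
  have hyc : Continuous y := hy.1.1.continuous
  have hvar := fun x => variation_of_constants hy.1.hasDerivAt hy.1.continuous_deriv
    (intervalIntegrable_potential_mul hq hyc) hy.1.deriv_sub_deriv x 1
  have hb := volterra_bound hq (w := z) hyc (Real.exp_pos (2 * |z.im|)).le hQ
    (α := fun x => Complex.exp (Complex.I * z * x)) (by
      intro x hx
      rw [hvar x, hy.deriv_one, hy.2 1 le_rfl]
      congr 1
      have e1 := mul_freeSine z (1 - x)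
      have e2 : Complex.exp (Complex.I * z * x) = Complex.exp (Complex.I * z) *
          (Complex.cos (z * ((1 - x : ℝ) : ℂ)) - Complex.sin (z * ((1 - x : ℝ) : ℂ)) *
            Complex.I) := by
        have e3 := Complex.exp_mul_I (-(z * ((1 - x : ℝ) : ℂ)))
        rw [Complex.cos_neg, Complex.sin_neg, neg_mul, neg_mul, ← sub_eq_add_neg] at e3
        rw [← e3, ← Complex.exp_add]
        congr 1; push_cast; ring
      rw [e2, ← e1]
      push_cast
      ring_nf) (by
      intro x hx
      have h1 := norm_exp_I_mul_le (z * x)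
      rw [← mul_assoc] at h1
      have h2 : |(z * (x : ℂ)).im| ≤ |z.im| := by
        simp only [Complex.im_mul_ofReal, abs_mul]
        exact mul_le_of_le_one_right (abs_nonneg _) (abs_le.2 hx)
      calc _ ≤ Real.exp (|z.im| * x) * Real.exp |z.im| := by
            gcongr; exact h1.trans (Real.exp_le_exp.2 h2)
        _ ≤ _ := by
            rw [← Real.exp_add]
            apply Real.exp_le_exp.2
            nlinarith [abs_nonneg z.im, hx.2])
  intro x hx
  have h1 := hb x hx
  have h2 : Real.exp (-|z.im|) ≤ Real.exp (|z.im| * x) := by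
    apply Real.exp_le_exp.2; nlinarith [abs_nonneg z.im, hx.1]
  have h3 : Real.exp (-|z.im|) * ‖y x‖ ≤ Real.exp (2 * |z.im|) * Real.exp (2 * Q) :=
    (by gcongr : _ ≤ Real.exp (|z.im| * x) * ‖y x‖).trans h1
  calc ‖y x‖ = Real.exp |z.im| * (Real.exp (-|z.im|) * ‖y x‖) := by
        rw [← mul_assoc, ← Real.exp_add]; simp
    _ ≤ Real.exp |z.im| * (Real.exp (2 * |z.im|) * Real.exp (2 * Q)) := by gcongr
    _ = _ := by rw [← Real.exp_add, ← Real.exp_add]; ring_nf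

lemma sFun_eq {q : ℝ → ℝ} (hq : IsPotential q) (z : ℂ) :
    sFun q z = jostPlus q z (-1) * (Complex.I * z * Complex.exp (-(Complex.I * z))) -
      deriv (jostPlus q z) (-1) * Complex.exp (-(Complex.I * z)) := by
  have h := isJostMinus_jostMinus hq (-z)
  rw [sFun, wronskian, h.deriv_neg_one, h.2 (-1) le_rfl]
  push_cast
  ring_nf

/-- The Wronskian of `exp (i z t)` and `f⁺` has derivative `exp (i z t) q f⁺`. It vanishes at `1`,
where `f⁺` is the exponential, and equals `-s z` at `-1`. Unlike the Wronskian formula, the integral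
shows no factor `z`. -/
lemma sFun_eq_integral {q : ℝ → ℝ} (hq : IsPotential q) (z : ℂ) :
    sFun q z = ∫ t in (-1 : ℝ)..1,
      Complex.exp (Complex.I * z * t) * ((q t : ℂ) * jostPlus q z t) := by
  have hy := isJostPlus_jostPlus hq z
  rw [sFun_eq hq]
  set y := jostPlus q z
  have hyc : Continuous y := hy.1.1.continuous
  have hqy := intervalIntegrable_potential_mul hq.1 hyc
  have hE := hasDerivAt_exp_mul (Complex.I * z)
  have ftc : ∀ {f f' : ℝ → ℂ}, (∀ t, HasDerivAt f (f' t) t) → Continuous f' →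
      ∀ a b, f b - f a = ∫ t in a..b, f' t := fun hf hf' a b =>
    (intervalIntegral.integral_eq_sub_of_hasDerivAt (fun t _ => hf t)
      (hf'.intervalIntegrable _ _)).symm
  have hEc : Continuous fun t : ℝ => Complex.exp (Complex.I * z * t) := by fun_prop
  have hgd : ∀ a b, IntervalIntegrable (fun t => (q t : ℂ) * y t - z ^ 2 * y t) volume a b :=
    fun a b => (hqy a b).sub ((hyc.const_mul _).intervalIntegrable _ _)
  have hyd := hy.1.continuous_deriv
  have e1 := mul_sub_mul_eq_integral (fun a b => (hEc.const_mul _).intervalIntegrable a b) hgd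
    (ftc hE (hEc.const_mul _)) hy.1.deriv_sub_deriv (-1) 1
  have e2 := mul_sub_mul_eq_integral
    (fun a b => ((hEc.const_mul _).const_mul (Complex.I * z)).intervalIntegrable a b)
    (fun a b => hyd.intervalIntegrable a b)
    (ftc (fun t => (hE t).const_mul (Complex.I * z)) ((hEc.const_mul _).const_mul _))
    (ftc hy.1.hasDerivAt hyd) (-1) 1
  have i1 : IntervalIntegrable (fun t : ℝ =>
      Complex.I * z * Complex.exp (Complex.I * z * t) * deriv y t +
      Complex.exp (Complex.I * z * t) * ((q t : ℂ) * y t - z ^ 2 * y t)) volume (-1) 1 :=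
    (((hEc.const_mul (Complex.I * z)).mul hyd).intervalIntegrable _ _).add
      ((hgd (-1) 1).continuousOn_mul hEc.continuousOn)
  have i2 : IntervalIntegrable (fun t : ℝ =>
      Complex.I * z * (Complex.I * z * Complex.exp (Complex.I * z * t)) * y t +
      Complex.I * z * Complex.exp (Complex.I * z * t) * deriv y t) volume (-1) 1 :=
    ((((hEc.const_mul (Complex.I * z)).const_mul (Complex.I * z)).mul hyc).add
      ((hEc.const_mul (Complex.I * z)).mul hyd)).intervalIntegrable _ _
  have e3 := congrArg₂ (· - ·) e1 e2
  simp only [← intervalIntegral.integral_sub i1 i2] at e3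
  have e4 : ∀ t : ℝ, Complex.exp (Complex.I * z * t) * ((q t : ℂ) * y t) =
      Complex.I * z * Complex.exp (Complex.I * z * t) * deriv y t +
      Complex.exp (Complex.I * z * t) * ((q t : ℂ) * y t - z ^ 2 * y t) -
      (Complex.I * z * (Complex.I * z * Complex.exp (Complex.I * z * t)) * y t +
      Complex.I * z * Complex.exp (Complex.I * z * t) * deriv y t) := by
    intro t
    linear_combination (Complex.exp (Complex.I * z * t) * z ^ 2 * y t) * Complex.I_sq
  simp only [e4]
  rw [← e3, hy.deriv_one, hy.2 1 le_rfl]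
  push_cast
  ring_nf

/-- Only `Im z` enters, so one estimate yields both exponential type (at most `4`) and boundedness
on the real line. -/
lemma norm_sFun_le {q : ℝ → ℝ} (hq : IsPotential q) {Q : ℝ} (hQ : ∫ t, |q t| ≤ Q) (z : ℂ) :
    ‖sFun q z‖ ≤ Q * Real.exp (2 * Q) * Real.exp (4 * |z.im|) := by
  have hb := (isJostPlus_jostPlus hq z).bound hq.1 hQ
  rw [sFun_eq_integral hq]
  have h1 : ‖∫ t in (-1 : ℝ)..1, Complex.exp (Complex.I * z * t) *
      ((q t : ℂ) * jostPlus q z t)‖ ≤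
      ∫ t in (-1 : ℝ)..1, Real.exp |z.im| * Real.exp (3 * |z.im| + 2 * Q) * |q t| := by
    refine intervalIntegral.norm_integral_le_of_norm_le (by norm_num)
      (Eventually.of_forall fun t ht => ?_) (hq.1.abs.const_mul _).intervalIntegrable
    have ht' : t ∈ Icc (-1 : ℝ) 1 := ⟨ht.1.le, ht.2⟩
    have h2 := norm_exp_I_mul_le (z * t)
    rw [← mul_assoc] at h2
    have h3 : |(z * (t : ℂ)).im| ≤ |z.im| := by
      simp only [Complex.im_mul_ofReal, abs_mul]
      exact mul_le_of_le_one_right (abs_nonneg _) (abs_le.2 ht')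
    rw [norm_mul, norm_mul, Complex.norm_real, Real.norm_eq_abs]
    calc _ ≤ Real.exp |z.im| * (|q t| * Real.exp (3 * |z.im| + 2 * Q)) := by
          gcongr
          · exact h2.trans (Real.exp_le_exp.2 h3)
          · exact hb t ht'
      _ = _ := by ring
  refine h1.trans ?_
  rw [intervalIntegral.integral_const_mul, ← Real.exp_add]
  calc _ ≤ Real.exp (|z.im| + (3 * |z.im| + 2 * Q)) * Q := by
        gcongr
        exact (integral_abs_le_of_integrable hq.1 (by norm_num)).trans hQ
    _ = _ := by rw [mul_assoc, ← Real.exp_add]; ring_nf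

/-! ### Holomorphy of `s`. -/

/-- Lagrange's identity: the potential cancels in `y g'' - y'' g`. The factor `z ^ 2 - w ^ 2` is
what later lets differentiability of `s` follow from continuity of `f⁺` in `z`. -/
lemma wronskian_sub_wronskian {q : ℝ → ℝ} (hq : Integrable q) {z w : ℂ} {y g : ℝ → ℂ}
    (hy : IsSchrodingerSolution q z y) (hg : IsSchrodingerSolution q w g) (a b : ℝ) :
    wronskian y g b - wronskian y g a = (z ^ 2 - w ^ 2) * ∫ t in a..b, y t * g t := by
  have hyc : Continuous y := hy.1.continuous
  have hgc : Continuous g := hg.1.continuous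
  have ftc : ∀ {u : ℂ} {f : ℝ → ℂ}, IsSchrodingerSolution q u f →
      ∀ a b, f b - f a = ∫ t in a..b, deriv f t := fun hf a b =>
    (intervalIntegral.integral_eq_sub_of_hasDerivAt (fun t _ => hf.hasDerivAt t)
      (hf.continuous_deriv.intervalIntegrable _ _)).symm
  have hi : ∀ {u : ℂ} {f : ℝ → ℂ}, IsSchrodingerSolution q u f → ∀ a b,
      IntervalIntegrable (fun t => ((q t : ℂ) - u ^ 2) * f t) volume a b := fun hf a b =>
    ((hq.ofReal.intervalIntegrable).sub intervalIntegrable_const).mul_continuousOn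
      hf.1.continuous.continuousOn
  have hi' : ∀ {u : ℂ} {f : ℝ → ℂ}, IsSchrodingerSolution q u f → ∀ a b,
      IntervalIntegrable (deriv f) volume a b := fun hf a b =>
    hf.continuous_deriv.intervalIntegrable a b
  have e1 := mul_sub_mul_eq_integral (hi' hy) (hi hg) (ftc hy) hg.2 a b
  have e2 := mul_sub_mul_eq_integral (hi hy) (hi' hg) hy.2 (ftc hg) a b
  have i1 := ((hi' hy a b).mul_continuousOn hg.continuous_deriv.continuousOn).add
    ((hi hg a b).continuousOn_mul hyc.continuousOn)
  have i2 := ((hi hy a b).mul_continuousOn hgc.continuousOn).add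
    ((hi' hg a b).continuousOn_mul hy.continuous_deriv.continuousOn)
  have e3 := congrArg₂ (· - ·) e1 e2
  simp only [← intervalIntegral.integral_sub i1 i2] at e3
  rw [← intervalIntegral.integral_const_mul]
  have e4 : ∀ t : ℝ, (z ^ 2 - w ^ 2) * (y t * g t) =
      deriv y t * deriv g t + y t * (((q t : ℂ) - w ^ 2) * g t) -
      (((q t : ℂ) - z ^ 2) * y t * g t + deriv y t * deriv g t) := fun t => by ring
  simp only [e4]
  rw [← e3, wronskian, wronskian]
  ring

/-- The Jost solution `f⁺(·, z)` depends continuously on `z`, uniformly on `[-1, 1]`. -/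
lemma exists_modulus_jostPlus {q : ℝ → ℝ} (hq : IsPotential q) (w : ℂ) :
    ∃ ω : ℂ → ℝ, Tendsto ω (𝓝 w) (𝓝 0) ∧ ∀ z, ∀ x ∈ Icc (-1 : ℝ) 1,
      ‖jostPlus q z x - jostPlus q w x‖ ≤ ω z := by
  set Q := ∫ t, |q t| with hQ
  set β := |w.im| with hβ
  -- `D z` bounds the weighted inhomogeneous term for the difference: its data at `1`, and the
  -- source `(w² - z²) f⁺(·, z)` over an interval of length at most `2`. The factor `2 exp (2β)`
  -- covers both the cosine and the `freeSine` kernel. All terms vanish at `z = w`.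
  let D : ℂ → ℝ := fun z => Real.exp β * (2 * Real.exp (2 * β) *
    (‖Complex.exp (Complex.I * z) - Complex.exp (Complex.I * w)‖ +
      ‖Complex.I * z * Complex.exp (Complex.I * z) -
        Complex.I * w * Complex.exp (Complex.I * w)‖ +
      2 * (‖w ^ 2 - z ^ 2‖ * Real.exp (3 * |z.im| + 2 * Q))))
  have hDc : Continuous D := by fun_prop
  refine ⟨fun z => Real.exp β * (D z * Real.exp (2 * Q)), ?_, ?_⟩
  · have h : Continuous fun z => Real.exp β * (D z * Real.exp (2 * Q)) := by fun_prop
    have h0 : Real.exp β * (D w * Real.exp (2 * Q)) = 0 := by simp [D]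
    simpa [h0] using h.tendsto w
  intro z x hx
  have hz := isJostPlus_jostPlus hq z
  have hw := isJostPlus_jostPlus hq w
  have hzb := hz.bound hq.1 le_rfl
  set y := jostPlus q z
  set v := jostPlus q w
  have hyc : Continuous y := hz.1.1.continuous
  have hvc : Continuous v := hw.1.1.continuous
  have hdc : Continuous fun t => y t - v t := hyc.sub hvc
  have hqd := intervalIntegrable_potential_mul hq.1 hdc
  have hr : Continuous fun t => (w ^ 2 - z ^ 2) * y t := hyc.const_mul _
  have hvar := fun x => variation_of_constants (w := w)
    (d := fun t => y t - v t) (d' := fun t => deriv y t - deriv v t)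
    (g := fun t => (q t : ℂ) * (y t - v t) + (w ^ 2 - z ^ 2) * y t)
    (fun t => (hz.1.hasDerivAt t).sub (hw.1.hasDerivAt t))
    (hz.1.continuous_deriv.sub hw.1.continuous_deriv)
    (fun a b => (hqd a b).add (hr.intervalIntegrable a b)) (by
      intro a b
      have e1 := hz.1.deriv_sub_deriv a b
      have e2 := hw.1.deriv_sub_deriv a b
      have i1 : ∀ {c : ℂ} {f : ℝ → ℂ}, Continuous f → IntervalIntegrable
          (fun t => (q t : ℂ) * f t - c ^ 2 * f t) volume a b := fun hf =>
        (intervalIntegrable_potential_mul hq.1 hf a b).sub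
          ((hf.const_mul _).intervalIntegrable a b)
      rw [sub_sub_sub_comm, e1, e2, ← intervalIntegral.integral_sub (i1 hyc) (i1 hvc)]
      congr 1; funext t; ring) x 1
  have hSc : ∀ x : ℝ, Continuous fun t => freeSine w (t - x) := fun x =>
    (continuous_freeSine w).comp (continuous_id.sub continuous_const)
  have hS : ∀ x ∈ Icc (-1 : ℝ) 1, ∀ t ∈ Icc x 1,
      ‖freeSine w (t - x)‖ ≤ 2 * Real.exp (2 * β) := by
    intro x hx t ht
    have h0 : 0 ≤ t - x := by linarith [ht.1]
    have h2 : t - x ≤ 2 := by linarith [ht.2, hx.1]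
    have h1 := norm_freeSine_le w (t - x)
    rw [abs_of_nonneg h0] at h1
    calc _ ≤ Real.exp (β * (t - x)) * (t - x) := h1
      _ ≤ Real.exp (β * 2) * 2 := by gcongr
      _ = _ := by ring_nf
  have hC : ∀ x ∈ Icc (-1 : ℝ) 1, ‖Complex.cos (w * ((1 - x : ℝ) : ℂ))‖ ≤
      2 * Real.exp (2 * β) := by
    intro x hx
    have h0 : 0 ≤ 1 - x := by linarith [hx.2]
    have h2 : 1 - x ≤ 2 := by linarith [hx.1]
    have h1 := norm_cos_mul_le w (1 - x)
    rw [abs_of_nonneg h0] at h1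
    calc _ ≤ Real.exp (β * (1 - x)) := h1
      _ ≤ Real.exp (β * 2) := by gcongr
      _ ≤ _ := by rw [mul_comm]; linarith [Real.exp_pos (2 * β)]
  have hD0 : 0 ≤ D z := by positivity
  have key := volterra_bound hq.1 (w := w) hdc hD0 le_rfl
    (α := fun x => Complex.cos (w * ((1 - x : ℝ) : ℂ)) * (y 1 - v 1) -
      freeSine w (1 - x) * (deriv y 1 - deriv v 1) +
      ∫ t in x..1, freeSine w (t - x) * ((w ^ 2 - z ^ 2) * y t)) (by
      intro x hx
      rw [hvar x, add_assoc]
      congr 1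
      have i1 : IntervalIntegrable (fun t => freeSine w (t - x) * ((w ^ 2 - z ^ 2) * y t))
        volume x 1 := ((hSc x).mul hr).intervalIntegrable _ _
      rw [← intervalIntegral.integral_add i1
        ((hqd x 1).continuousOn_mul (hSc x).continuousOn)]
      congr 1; funext t; ring) (by
      intro x hx
      rw [hz.2 1 le_rfl, hw.2 1 le_rfl, hz.deriv_one, hw.deriv_one]
      have hint : ‖∫ t in x..1, freeSine w (t - x) * ((w ^ 2 - z ^ 2) * y t)‖ ≤
          (2 * Real.exp (2 * β) * (‖w ^ 2 - z ^ 2‖ * Real.exp (3 * |z.im| + 2 * Q))) *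
            |1 - x| := by
        apply intervalIntegral.norm_integral_le_of_norm_le_const
        intro t ht
        rw [uIoc_of_le hx.2] at ht
        rw [norm_mul, norm_mul]
        gcongr
        · exact hS x hx t ⟨ht.1.le, ht.2⟩
        · exact hzb t ⟨by linarith [ht.1, hx.1], ht.2⟩
      have h1 : |1 - x| ≤ 2 := by rw [abs_le]; constructor <;> linarith [hx.1, hx.2]
      have hE : Real.exp (β * x) ≤ Real.exp β := by
        apply Real.exp_le_exp.2
        exact mul_le_of_le_one_right (abs_nonneg _) hx.2
      simp only [D, Complex.ofReal_one, mul_one]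
      gcongr
      refine (norm_add_le _ _).trans ?_
      have h2 := hint.trans (mul_le_mul_of_nonneg_left h1 (by positivity))
      have h3 := norm_sub_le (Complex.cos (w * ((1 - x : ℝ) : ℂ)) *
        (Complex.exp (Complex.I * z) - Complex.exp (Complex.I * w)))
        (freeSine w (1 - x) * (Complex.I * z * Complex.exp (Complex.I * z) -
          Complex.I * w * Complex.exp (Complex.I * w)))
      rw [norm_mul, norm_mul] at h3
      have h4 := mul_le_mul_of_nonneg_right (hC x hx)
        (norm_nonneg (Complex.exp (Complex.I * z) - Complex.exp (Complex.I * w)))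
      have h5 := mul_le_mul_of_nonneg_right (hS x hx 1 ⟨hx.2, le_rfl⟩)
        (norm_nonneg (Complex.I * z * Complex.exp (Complex.I * z) -
          Complex.I * w * Complex.exp (Complex.I * w)))
      linarith) x hx
  have h2 : Real.exp (-β) ≤ Real.exp (β * x) := by
    apply Real.exp_le_exp.2; nlinarith [abs_nonneg w.im, hx.1]
  calc ‖y x - v x‖ = Real.exp β * (Real.exp (-β) * ‖y x - v x‖) := by
        rw [← mul_assoc, ← Real.exp_add]; simp
    _ ≤ Real.exp β * (Real.exp (β * x) * ‖y x - v x‖) := by gcongr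
    _ ≤ _ := mul_le_mul_of_nonneg_left key (Real.exp_pos _).le

/-- The difference quotient at `w` is `k` itself, so continuity of `k` at this one point is enough.
-/
lemma hasDerivAt_sub_mul {k : ℂ → ℂ} {w : ℂ} (hk : ContinuousAt k w) :
    HasDerivAt (fun z => (z - w) * k z) (k w) w := by
  rw [hasDerivAt_iff_tendsto_slope]
  refine (hk.tendsto.mono_left nhdsWithin_le_nhds).congr' ?_
  filter_upwards [self_mem_nhdsWithin] with z hz
  have : z - w ≠ 0 := sub_ne_zero.2 hz
  rw [slope_def_field, sub_self, zero_mul, sub_zero]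
  field_simp

/-- The function `s` is entire. -/
theorem differentiable_sFun {q : ℝ → ℝ} (hq : IsPotential q) : Differentiable ℂ (sFun q) := by
  intro w
  obtain ⟨ω, hω, hωb⟩ := exists_modulus_jostPlus hq w
  have hg := isJostMinus_jostMinus hq (-w)
  set g := jostMinus q (-w)
  have hgc : Continuous g := hg.1.1.continuous
  obtain ⟨G, hG⟩ := isCompact_Icc.exists_bound_of_continuousOn (s := Icc (-1 : ℝ) 1)
    hgc.continuousOn
  let J : ℂ → ℂ := fun z => ∫ t in (-1 : ℝ)..1, jostPlus q z t * g t
  have hyc : ∀ z, Continuous (jostPlus q z) := fun z => (isJostPlus_jostPlus hq z).1.1.continuous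
  have hJ : ContinuousAt J w := by
    rw [ContinuousAt, tendsto_iff_norm_sub_tendsto_zero]
    have h0 : Tendsto (fun z => ω z * G * |(1 : ℝ) - (-1)|) (𝓝 w) (𝓝 0) := by
      simpa using (hω.mul_const G).mul_const |(1 : ℝ) - (-1)|
    refine squeeze_zero (fun _ => norm_nonneg _) (fun z => ?_) h0
    simp only [J]
    have i1 : ∀ z, IntervalIntegrable (fun t => jostPlus q z t * g t) volume (-1) 1 := fun z =>
      ((hyc z).mul hgc).intervalIntegrable _ _
    rw [← intervalIntegral.integral_sub (i1 z) (i1 w)]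
    apply intervalIntegral.norm_integral_le_of_norm_le_const
    intro t ht
    rw [uIoc_of_le (by norm_num)] at ht
    have ht' : t ∈ Icc (-1 : ℝ) 1 := ⟨ht.1.le, ht.2⟩
    rw [← sub_mul, norm_mul]
    exact mul_le_mul (hωb z t ht') (hG t ht') (norm_nonneg _)
      ((norm_nonneg _).trans (hωb z t ht'))
  have hY : ContinuousAt (fun z => jostPlus q z (-1)) w := by
    rw [ContinuousAt, tendsto_iff_norm_sub_tendsto_zero]
    exact squeeze_zero (fun _ => norm_nonneg _) (fun z => hωb z _ (by norm_num)) hω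
  have hk : ContinuousAt (fun z => -(z + w) * Complex.exp (Complex.I * (w - z)) * J z +
      Complex.I * Complex.exp (-(Complex.I * z)) * jostPlus q z (-1)) w := by
    have h1 : Continuous fun z : ℂ => -(z + w) * Complex.exp (Complex.I * (w - z)) := by fun_prop
    have h2 : Continuous fun z : ℂ => Complex.I * Complex.exp (-(Complex.I * z)) := by fun_prop
    exact (h1.continuousAt.mul hJ).add (h2.continuousAt.mul hY)
  -- Replace `f⁻(·, -z)` by the fixed solution `g = f⁻(·, -w)`. The Wronskian with `g` is explicit
  -- and entire in `z` at the point `1`; moving it to `-1` and correcting the boundary data there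
  -- both cost a multiple of `z - w`.
  have e : sFun q = fun z => Complex.exp (Complex.I * (w - z)) *
      (Complex.exp (Complex.I * z) * (deriv g 1 - Complex.I * z * g 1)) +
      (z - w) * (-(z + w) * Complex.exp (Complex.I * (w - z)) * J z +
        Complex.I * Complex.exp (-(Complex.I * z)) * jostPlus q z (-1)) := by
    funext z
    have hy := isJostPlus_jostPlus hq z
    have h1 := wronskian_sub_wronskian hq.1 hy.1 hg.1 (-1) 1
    rw [sFun_eq hq]
    simp only [wronskian] at h1
    rw [hy.deriv_one, hy.2 1 le_rfl, hg.deriv_neg_one, hg.2 (-1) le_rfl] at h1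
    have h2 : Complex.exp (-(Complex.I * z)) =
        Complex.exp (Complex.I * (w - z)) * Complex.exp (-(Complex.I * w)) := by
      rw [← Complex.exp_add]; ring_nf
    have h3 : J z = ∫ t in (-1 : ℝ)..1, jostPlus q z t * g t := rfl
    rw [← h3] at h1
    have h4 : Complex.exp (Complex.I * -w) = Complex.exp (-(Complex.I * w)) := by ring_nf
    have h5 : Complex.exp (-(Complex.I * -w * ((-1 : ℝ) : ℂ))) =
      Complex.exp (-(Complex.I * w)) := by push_cast; ring_nf
    rw [h4, h5] at h1
    push_cast at h1
    rw [mul_one] at h1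
    rw [h2]
    linear_combination (-Complex.exp (Complex.I * (w - z))) * h1
  rw [e]
  exact (by fun_prop : DifferentiableAt ℂ (fun z => Complex.exp (Complex.I * (w - z)) *
    (Complex.exp (Complex.I * z) * (deriv g 1 - Complex.I * z * g 1))) w).add
    (hasDerivAt_sub_mul hk).differentiableAt

/-! ### Truncated Hadamard factorization. -/

/-- Dividing an entire function by the polynomial that has the same zeros in a set `U`. -/
lemma exists_eq_prod_sub_mul {U : Set ℂ} : ∀ {N : ℕ} (a : Fin N → ℂ) {f : ℂ → ℂ},
    Differentiable ℂ f → (∀ n, a n ∈ U) →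
    (∀ z ∈ U, ((Nat.card {n : Fin N // a n = z} : ℕ) : ℕ∞) = analyticOrderAt f z) →
    ∃ g : ℂ → ℂ, Differentiable ℂ g ∧ (∀ z, f z = (∏ n, (z - a n)) * g z) ∧ ∀ z ∈ U, g z ≠ 0
  | 0, a, f, hf, _, ho => by
    refine ⟨f, hf, fun z => by simp, fun z hz => ?_⟩
    have := ho z hz
    simp only [Nat.card_of_isEmpty, Nat.cast_zero] at this
    exact ((hf.analyticAt z).analyticOrderAt_eq_zero).1 this.symm
  | N + 1, a, f, hf, ha, ho => by
    have hcard : ∀ z, Nat.card {n : Fin (N + 1) // a n = z} =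
        (if a 0 = z then 1 else 0) + Nat.card {n : Fin N // a n.succ = z} := by
      intro z
      classical
      simp only [Nat.card_eq_fintype_card, Fintype.card_subtype]
      rw [Fin.card_filter_univ_succ]
      split_ifs <;> simp [add_comm]
    have hf0 : f (a 0) = 0 := by
      have h := ho (a 0) (ha 0)
      rw [hcard, if_pos rfl] at h
      apply apply_eq_zero_of_analyticOrderAt_ne_zero (𝕜 := ℂ)
      rw [← h]
      simp
    set g := dslope f (a 0) with hgdef
    have hg : Differentiable ℂ g := by
      rw [← differentiableOn_univ] at hf ⊢
      exact (Complex.differentiableOn_dslope univ_mem).2 hf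
    have hfg : ∀ z, f z = (z - a 0) * g z := by
      intro z
      have := sub_smul_dslope f (a 0) z
      rw [hf0, sub_zero, smul_eq_mul] at this
      exact this.symm
    have hlin : ∀ z, analyticOrderAt (fun x => x - a 0) z = ((if a 0 = z then 1 else 0 : ℕ) : ℕ∞) := by
      intro z
      split_ifs with h
      · rw [← h]; simp
      · simpa using analyticOrderAt_id_sub_const_of_ne (Ne.symm h)
    obtain ⟨k, hk, hgk, hk0⟩ := exists_eq_prod_sub_mul (fun n : Fin N => a n.succ) hg
      (fun n => ha _) (by
        intro z hz
        have h1 := ho z hz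
        have h2 : f = (fun x => x - a 0) * g := funext hfg
        rw [h2, analyticOrderAt_mul
          ((by fun_prop : Differentiable ℂ fun x => x - a 0).analyticAt z)
          (hg.analyticAt z), hlin, hcard, Nat.cast_add] at h1
        -- Orders add under products, and the order of the linear factor is finite, so it cancels in
        -- `ℕ∞`.
        exact (ENat.add_right_injective_of_ne_top (ENat.natCast_ne_top _)) h1)
    refine ⟨k, hk, fun z => ?_, hk0⟩
    rw [hfg, hgk, Fin.prod_univ_succ, mul_assoc]

/-- A nonvanishing holomorphic function on a disk has a logarithm. -/
lemma exists_log_on_ball {k : ℂ → ℂ} {R : ℝ} (hk : DifferentiableOn ℂ k (Metric.ball 0 R))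
    (hk0 : ∀ z ∈ Metric.ball (0 : ℂ) R, k z ≠ 0) (hk1 : k 0 = 1) :
    ∃ h : ℂ → ℂ, h 0 = 0 ∧ (∀ z ∈ Metric.ball (0 : ℂ) R, HasDerivAt h (deriv k z / k z) z) ∧
      ∀ z ∈ Metric.ball (0 : ℂ) R, k z = Complex.exp (h z) := by
  have hkd : DifferentiableOn ℂ (fun z => deriv k z / k z) (Metric.ball 0 R) :=
    (hk.deriv Metric.isOpen_ball).div hk hk0
  obtain ⟨h, h0, hh⟩ := (hkd.isExactOn_ball).with_val_at 0 0
  refine ⟨h, h0, hh, fun z hz => ?_⟩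
  have hd : ∀ w ∈ Metric.ball (0 : ℂ) R,
      HasDerivAt (fun w => k w * Complex.exp (-h w)) 0 w := by
    intro w hw
    have h1 := ((hk w hw).differentiableAt (Metric.isOpen_ball.mem_nhds hw)).hasDerivAt
    refine (h1.mul (hh w hw).neg.cexp).congr_deriv ?_
    have := hk0 w hw
    field_simp
    simp
  have h0R : (0 : ℂ) ∈ Metric.ball (0 : ℂ) R :=
    Metric.mem_ball_self (Metric.nonempty_ball.1 ⟨z, hz⟩)
  have hconst := (convex_ball (0 : ℂ) R).is_const_of_fderivWithin_eq_zero (𝕜 := ℂ)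
    (f := fun w => k w * Complex.exp (-h w))
    (fun w hw => (hd w hw).differentiableAt.differentiableWithinAt)
    (fun w hw => by
      rw [fderivWithin_of_isOpen Metric.isOpen_ball hw]
      ext; simp [(hd w hw).deriv]) hz h0R
  simp only [h0, hk1, neg_zero, Complex.exp_zero, mul_one, Complex.exp_neg] at hconst
  exact (mul_inv_eq_one₀ (Complex.exp_ne_zero _)).1 hconst

/-- The second order Taylor remainder of a holomorphic function with bounded real part. -/
lemma norm_sub_deriv_mul_le {h : ℂ → ℂ} {R M : ℝ} (hR : 0 < R) (hM : 0 < M)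
    (hh : DifferentiableOn ℂ h (Metric.ball 0 R)) (h0 : h 0 = 0)
    (hre : ∀ z ∈ Metric.ball (0 : ℂ) R, (h z).re ≤ M) {z : ℂ} (hz : ‖z‖ < R / 2) :
    ‖h z - deriv h 0 * z‖ ≤ 16 * M * (‖z‖ / R) ^ 2 := by
  have hsub : Metric.ball (0 : ℂ) (R / 2) ⊆ Metric.ball 0 R := Metric.ball_subset_ball (by linarith)
  -- Borel–Carathéodory: `2 M r / (R - r) ≤ 2 M` for `r < R / 2`.
  have hb : ∀ w ∈ Metric.ball (0 : ℂ) (R / 2), ‖h w‖ ≤ 2 * M := by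
    intro w hw
    have h1 := Complex.borelCaratheodory_zero hM hh hre hR (hsub hw) h0
    rw [mem_ball_zero_iff] at hw
    refine h1.trans ((div_le_iff₀ (by linarith)).2 ?_)
    nlinarith
  have hh' := hh.mono hsub
  have hd : ‖deriv h 0‖ ≤ 2 * M / (R / 2) :=
    Complex.norm_deriv_le_div_of_mapsTo_ball hh' (fun w hw => by simpa [h0] using hb w hw)
      (by linarith)
  have hda : DifferentiableAt ℂ h 0 :=
    (hh 0 (Metric.mem_ball_self hR)).differentiableAt (Metric.ball_mem_nhds _ hR)
  -- Schwarz lemma for a function vanishing to second order: `h w - h'(0) w` is `o(w)` and at most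
  -- `4 M` on the half disk, whence `4 M (2 ‖z‖ / R)²`.
  have key := Complex.dist_le_mul_div_pow_of_mapsTo_ball_of_isLittleO (n := 1)
    (f := fun w => h w - deriv h 0 * w) (c := 0) (z := z) (R₁ := R / 2) (R₂ := 4 * M)
    (hh'.sub (by fun_prop)) (fun w hw => by
      have h1 := hb w hw
      rw [mem_ball_zero_iff] at hw
      simp only [h0, mul_zero, sub_zero, mem_closedBall_zero_iff]
      refine (norm_sub_le _ _).trans ?_
      rw [norm_mul]
      have h2 : ‖deriv h 0‖ * ‖w‖ ≤ 2 * M / (R / 2) * (R / 2) := by gcongr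
      rw [div_mul_cancel₀ _ (by linarith)] at h2
      linarith) (by
      have h1 := hda.hasDerivAt.isLittleO
      simp only [smul_eq_mul, h0, sub_zero] at h1
      simp only [h0, mul_zero, sub_zero, pow_one]
      refine (h1.norm_right).congr_left fun w => ?_
      ring) (by simpa using hz)
  simp only [h0, mul_zero, sub_zero, dist_zero_right] at key
  have e : ‖z‖ / (R / 2) = 2 * (‖z‖ / R) := by field_simp
  rw [e] at key
  exact key.trans_eq (by ring)

/-- A truncated Hadamard factorization of an entire function of exponential type. -/
theorem exists_truncated_hadamard {s : ℂ → ℂ} (hs : Differentiable ℂ s) {M τ δ R : ℝ}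
    (hM : 0 < M) (hτ : 0 < τ) (hδ : 0 < δ) (hR : 1 ≤ R)
    (hb : ∀ z, ‖s z‖ ≤ M * Real.exp (τ * ‖z‖)) (h0 : δ ≤ ‖s 0‖) {N : ℕ} {a : Fin N → ℂ}
    (ha : ListsZeros s R a) {z : ℂ} (hz : ‖z‖ < R / 2) :
    ∃ r : ℂ, ‖r‖ ≤ 16 * (2 * τ + |Real.log (M / δ)|) * ‖z‖ ^ 2 / R ∧
      s z = s 0 * (∏ n, (1 - z / a n)) *
        Complex.exp ((deriv s 0 / s 0 + ∑ n, (a n)⁻¹) * z + r) := by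
  have hR0 : 0 < R := by linarith
  have hs0 : s 0 ≠ 0 := fun h => by rw [h, norm_zero] at h0; linarith
  obtain ⟨g, hg, hsg, hg0⟩ := exists_eq_prod_sub_mul a hs ha.1 ha.2
  have h0R : (0 : ℂ) ∈ Metric.ball (0 : ℂ) R := Metric.mem_ball_self hR0
  have hg00 := hg0 0 h0R
  have han : ∀ n, a n ≠ 0 := by
    intro n hn
    apply hs0
    rw [hsg 0, Finset.prod_eq_zero (Finset.mem_univ n) (by rw [hn, sub_zero]), zero_mul]
  set k : ℂ → ℂ := fun z => g z / g 0 with hkdef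
  have hk : Differentiable ℂ k := hg.div_const _
  have hk1 : k 0 = 1 := div_self hg00
  have hsk : ∀ z, s z = s 0 * (∏ n, (1 - z / a n)) * k z := by
    intro z
    have e : s 0 * (∏ n, (1 - z / a n)) * k z = (∏ n, (0 - a n) * (1 - z / a n)) * g z := by
      rw [hsg 0, hkdef, Finset.prod_mul_distrib]
      field_simp
    rw [hsg z, e]
    have : ∏ n, (0 - a n) * (1 - z / a n) = ∏ n, (z - a n) := by
      refine Finset.prod_congr rfl fun n _ => ?_
      have := han n
      field_simp
      ring
    rw [this]
  have hk0 : ∀ z ∈ Metric.ball (0 : ℂ) R, k z ≠ 0 := fun z hz => div_ne_zero (hg0 z hz) hg00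
  -- Maximum principle on the disk of radius `2R`: on its boundary `‖w / a n‖ ≥ 2`, so every factor
  -- has modulus at least `1` and the product can be dropped.
  have hkb : ∀ z ∈ Metric.ball (0 : ℂ) R, ‖k z‖ ≤ M / δ * Real.exp (2 * τ * R) := by
    intro z hz
    refine Complex.norm_le_of_forall_mem_frontier_norm_le (U := Metric.ball (0 : ℂ) (2 * R))
      Metric.isBounded_ball hk.diffContOnCl (fun w hw => ?_)
      (subset_closure (Metric.ball_subset_ball (by linarith) hz))
    rw [frontier_ball _ (by positivity), mem_sphere_zero_iff_norm] at hw
    have h1 : 1 ≤ ‖∏ n, (1 - w / a n)‖ := by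
      rw [norm_prod]
      refine Finset.prod_induction _ (fun x : ℝ => 1 ≤ x)
        (fun _ _ => one_le_mul_of_one_le_of_one_le) le_rfl fun n _ => ?_
      have h2 : ‖a n‖ < R := mem_ball_zero_iff.1 (ha.1 n)
      have h3 : 0 < ‖a n‖ := norm_pos_iff.2 (han n)
      have h4 : 2 ≤ ‖w / a n‖ := by
        rw [norm_div, hw, le_div_iff₀ h3]; linarith
      have h5 := norm_sub_norm_le (w / a n) 1
      rw [norm_one, norm_sub_rev] at h5
      linarith
    have h2 := hb w
    rw [hsk w, norm_mul, norm_mul, hw] at h2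
    have h3 : δ * 1 * ‖k w‖ ≤ ‖s 0‖ * ‖∏ n, (1 - w / a n)‖ * ‖k w‖ := by gcongr
    rw [div_mul_eq_mul_div, le_div_iff₀ hδ]
    calc ‖k w‖ * δ = δ * 1 * ‖k w‖ := by ring
      _ ≤ _ := h3.trans h2
      _ = _ := by ring_nf
  obtain ⟨h, hh0, hhd, hkh⟩ := exists_log_on_ball hk.differentiableOn hk0 hk1
  set K := 2 * τ + |Real.log (M / δ)| with hK
  have hK0 : 0 < K := by positivity
  have hre : ∀ z ∈ Metric.ball (0 : ℂ) R, (h z).re ≤ K * R := by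
    intro z hz
    have h1 := hkb z hz
    rw [hkh z hz, Complex.norm_exp, ← Real.exp_log (div_pos hM hδ), ← Real.exp_add,
      Real.exp_le_exp] at h1
    have h2 := le_abs_self (Real.log (M / δ))
    have h3 : |Real.log (M / δ)| ≤ |Real.log (M / δ)| * R :=
      le_mul_of_one_le_right (abs_nonneg _) hR
    rw [hK]; nlinarith
  have htay := norm_sub_deriv_mul_le hR0 (mul_pos hK0 hR0)
    (fun z hz => (hhd z hz).differentiableAt.differentiableWithinAt) hh0 hre hz
  have hder : deriv h 0 = deriv s 0 / s 0 + ∑ n, (a n)⁻¹ := by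
    rw [(hhd 0 h0R).deriv]
    have e1 : s = fun z => s 0 * ((∏ n, (1 - z / a n)) * k z) := by
      funext z; rw [hsk z, mul_assoc]
    have hpd : ∀ n, HasDerivAt (fun z => 1 - z / a n) (-(a n)⁻¹) 0 := fun n => by
      simpa using ((hasDerivAt_id (0 : ℂ)).div_const (a n)).const_sub 1
    have e2 : logDeriv s 0 = -∑ n, (a n)⁻¹ + logDeriv k 0 := by
      conv_lhs => rw [e1]
      rw [logDeriv_const_mul _ _ hs0, logDeriv_mul _ (by simp) (by simp [hk1])
        (DifferentiableAt.fun_finsetProd fun n _ => (hpd n).differentiableAt) (hk 0),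
        logDeriv_prod (by simp) (fun n _ => (hpd n).differentiableAt)]
      congr 1
      rw [← Finset.sum_neg_distrib]
      refine Finset.sum_congr rfl fun n _ => ?_
      rw [logDeriv_apply, (hpd n).deriv]
      simp
    rw [logDeriv_apply, logDeriv_apply] at e2
    rw [e2]; ring
  refine ⟨h z - deriv h 0 * z, htay.trans_eq (by field_simp), ?_⟩
  rw [← hder, add_sub_cancel, ← hkh z (mem_ball_zero_iff.2 (by linarith)), ← hsk]

/-- Zeros of an entire function of exponential type stay away from `0`. -/
lemma le_norm_of_zero {s : ℂ → ℂ} (hs : Differentiable ℂ s) {M τ δ : ℝ} (hM : 0 < M)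
    (hτ : 0 < τ) (hb : ∀ z, ‖s z‖ ≤ M * Real.exp (τ * ‖z‖)) (h0 : δ ≤ ‖s 0‖) {a : ℂ}
    (ha : s a = 0) : min 1 (δ / (2 * (M * Real.exp τ))) ≤ ‖a‖ := by
  by_contra! hlt
  obtain ⟨h1, h2⟩ := lt_min_iff.1 hlt
  have hball : ∀ w ∈ Metric.ball (0 : ℂ) 1, ‖s w‖ ≤ M * Real.exp τ := by
    intro w hw
    rw [mem_ball_zero_iff] at hw
    refine (hb w).trans ?_
    gcongr
    nlinarith
  -- Schwarz lemma on the unit disk: at a zero, `δ ≤ ‖s a - s 0‖ ≤ 2 M exp τ ‖a‖`.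
  have key := Complex.dist_le_div_mul_dist_of_mapsTo_ball (f := s) (c := 0) (z := a) (R₁ := 1)
    (R₂ := 2 * (M * Real.exp τ)) hs.differentiableOn (fun w hw => by
      rw [Metric.mem_closedBall, dist_eq_norm]
      refine (norm_sub_le _ _).trans ?_
      have := hball w hw
      have := hball 0 (Metric.mem_ball_self one_pos)
      linarith) (by simpa using h1)
  rw [ha, dist_zero_left, dist_zero_right, div_one] at key
  rw [lt_div_iff₀ (by positivity)] at h2
  linarith

/-! ### Comparison of products with nearby zeros. -/

/-- Measuring deviations from `1` as `exp X - 1` makes the exponents additive under products, with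
no smallness condition. -/
lemma norm_mul_sub_one_le {p q : ℂ} {X Y : ℝ} (hp : ‖p - 1‖ ≤ Real.exp X - 1)
    (hq : ‖q - 1‖ ≤ Real.exp Y - 1) : ‖p * q - 1‖ ≤ Real.exp (X + Y) - 1 := by
  have e : p * q - 1 = (p - 1) * (q - 1) + (p - 1) + (q - 1) := by ring
  rw [e, Real.exp_add]
  have h1 := norm_add_le ((p - 1) * (q - 1) + (p - 1)) (q - 1)
  have h2 := norm_add_le ((p - 1) * (q - 1)) (p - 1)
  have h3 : ‖(p - 1) * (q - 1)‖ ≤ (Real.exp X - 1) * (Real.exp Y - 1) := by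
    rw [norm_mul]
    exact mul_le_mul hp hq (norm_nonneg _) ((norm_nonneg _).trans hp)
  linarith

lemma norm_exp_sub_one_le_exp_norm_sub_one (w : ℂ) :
    ‖Complex.exp w - 1‖ ≤ Real.exp ‖w‖ - 1 := by
  simpa using Complex.norm_exp_sub_sum_le_exp_norm_sub_sum w 1

/-- Comparison of two functions given by truncated Hadamard products with nearby zeros. -/
lemma norm_sub_le_of_products {s₀ s₀' sz sz' c r r' : ℂ} {δ c₀ M K ε η : ℝ} {N : ℕ}
    {a a' : Fin N → ℂ} {z : ℂ} (hδ : 0 < δ) (hc₀ : 0 < c₀) (hε : 0 ≤ ε) (hη : 0 < η)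
    (hs₀ : δ ≤ ‖s₀‖) (ha : ∀ n, c₀ ≤ ‖a n‖) (ha' : ∀ n, c₀ ≤ ‖a' n‖)
    (haa' : ∀ n, ‖a n - a' n‖ ≤ ε) (hz : ∀ n, η ≤ ‖z - a n‖) (hr : ‖r‖ ≤ K) (hr' : ‖r'‖ ≤ K)
    (hsM : ‖sz‖ ≤ M) (hsM' : ‖sz'‖ ≤ M)
    (hs : sz = s₀ * (∏ n, (1 - z / a n)) * Complex.exp ((c + ∑ n, (a n)⁻¹) * z + r))
    (hs' : sz' = s₀' * (∏ n, (1 - z / a' n)) * Complex.exp ((c + ∑ n, (a' n)⁻¹) * z + r')) :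
    ‖sz - sz'‖ ≤ 2 * M * (‖s₀ - s₀'‖ / δ + (N * (ε / η) + (N * (ε / c₀) +
      (N * (ε / c₀ ^ 2) * ‖z‖ + 2 * K)))) := by
  set X := ‖s₀ - s₀'‖ / δ + (N * (ε / η) + (N * (ε / c₀) +
      (N * (ε / c₀ ^ 2) * ‖z‖ + 2 * K))) with hX
  have hM0 : 0 ≤ M := (norm_nonneg _).trans hsM
  have hK0 : 0 ≤ K := (norm_nonneg _).trans hr
  have hs0 : s₀ ≠ 0 := fun h => by rw [h, norm_zero] at hs₀; linarith
  have han : ∀ n, a n ≠ 0 := fun n h => by have := ha n; rw [h, norm_zero] at this; linarith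
  have han' : ∀ n, a' n ≠ 0 := fun n h => by have := ha' n; rw [h, norm_zero] at this; linarith
  have hzn : ∀ n, z - a n ≠ 0 := fun n h => by have := hz n; rw [h, norm_zero] at this; linarith
  -- The factors come from `(1 - z / a') / (1 - z / a) = ((z - a') / (z - a)) * (a / a')`. Only the
  -- distance from `z` to the zeros of the first function appears in a denominator.
  let P₁ : ℂ := ∏ n, (1 + (a n - a' n) / (z - a n))
  let P₂ : ℂ := ∏ n, (1 + (a n - a' n) / a' n)
  let W : ℂ := (∑ n, ((a' n)⁻¹ - (a n)⁻¹)) * z + (r' - r)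
  have hT : sz' = sz * ((1 + (s₀' - s₀) / s₀) * (P₁ * (P₂ * Complex.exp W))) := by
    have e1 : (∏ n, (1 - z / a' n)) = (∏ n, (1 - z / a n)) * (P₁ * P₂) := by
      simp only [P₁, P₂]
      rw [← Finset.prod_mul_distrib, ← Finset.prod_mul_distrib]
      refine Finset.prod_congr rfl fun n _ => ?_
      have h1 := han n
      have h2 := han' n
      have h3 := hzn n
      field_simp
      ring
    have e2 : Complex.exp ((c + ∑ n, (a' n)⁻¹) * z + r') =
        Complex.exp ((c + ∑ n, (a n)⁻¹) * z + r) * Complex.exp W := by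
      rw [← Complex.exp_add]
      congr 1
      simp only [W, Finset.sum_sub_distrib]
      ring
    rw [hs', hs, e1, e2]
    field_simp
    ring
  have hα : ‖(1 + (s₀' - s₀) / s₀) - 1‖ ≤ Real.exp (‖s₀ - s₀'‖ / δ) - 1 := by
    rw [add_sub_cancel_left, norm_div, norm_sub_rev]
    have h1 := Real.add_one_le_exp (‖s₀ - s₀'‖ / δ)
    have h2 : ‖s₀ - s₀'‖ / ‖s₀‖ ≤ ‖s₀ - s₀'‖ / δ := by gcongr
    linarith
  have hprod : ∀ (u : Fin N → ℂ) (B : ℝ), (∀ n, ‖u n‖ ≤ B) →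
      ‖∏ n, (1 + u n) - 1‖ ≤ Real.exp (N * B) - 1 := by
    intro u B hu
    refine (Finset.norm_prod_one_add_sub_one_le _ u).trans ?_
    gcongr
    simpa using Finset.sum_le_card_nsmul Finset.univ (fun n => ‖u n‖) B fun n _ => hu n
  have h₁ : ‖P₁ - 1‖ ≤ Real.exp (N * (ε / η)) - 1 := hprod _ _ fun n => by
    rw [norm_div]; exact div_le_div₀ hε (haa' n) hη (hz n)
  have h₂ : ‖P₂ - 1‖ ≤ Real.exp (N * (ε / c₀)) - 1 := hprod _ _ fun n => by
    rw [norm_div]; exact div_le_div₀ hε (haa' n) hc₀ (ha' n)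
  have hW : ‖W‖ ≤ N * (ε / c₀ ^ 2) * ‖z‖ + 2 * K := by
    refine (norm_add_le _ _).trans (add_le_add ?_ ?_)
    · rw [norm_mul]
      gcongr
      have : ∀ n ∈ Finset.univ, ‖(a' n)⁻¹ - (a n)⁻¹‖ ≤ ε / c₀ ^ 2 := by
        intro n _
        rw [inv_sub_inv (han' n) (han n), norm_div, norm_mul, sq]
        exact div_le_div₀ hε (haa' n) (by positivity)
          (mul_le_mul (ha' n) (ha n) hc₀.le (norm_nonneg _))
      simpa using norm_sum_le_of_le Finset.univ this
    · have := norm_sub_le r' r; linarith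
  have h₃ : ‖Complex.exp W - 1‖ ≤ Real.exp (N * (ε / c₀ ^ 2) * ‖z‖ + 2 * K) - 1 :=
    (norm_exp_sub_one_le_exp_norm_sub_one W).trans (by gcongr)
  have hfin := norm_mul_sub_one_le hα (norm_mul_sub_one_le h₁ (norm_mul_sub_one_le h₂ h₃))
  rw [← hX] at hfin
  have hX0 : 0 ≤ X := by positivity
  -- If `X ≤ 1`, then `exp X - 1 ≤ 2 X`; otherwise the trivial bound `2 M` is already below `2 M X`.
  rcases le_or_gt X 1 with hX1 | hX1
  · have h4 : Real.exp X - 1 ≤ 2 * X := by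
      have := Real.abs_exp_sub_one_le (abs_le.2 ⟨by linarith, hX1⟩)
      rw [abs_of_nonneg hX0] at this
      exact (le_abs_self _).trans this
    rw [norm_sub_rev]
    nth_rewrite 1 [hT]
    rw [← mul_sub_one, norm_mul]
    calc _ ≤ M * (2 * X) := mul_le_mul hsM (hfin.trans h4) (norm_nonneg _) hM0
      _ = _ := by ring
  · have := norm_sub_le sz sz'
    nlinarith

/-! ### The stability estimate. -/

theorem mainTheorem6 :
    ∃ R₀ C E : ℝ → ℝ → ℝ, ∀ Q δ : ℝ, 0 < Q → 0 < δ →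
      0 < R₀ Q δ ∧ 0 < C Q δ ∧
      ∀ R : ℝ, R₀ Q δ ≤ R →
        0 < E Q R ∧
        ∀ q q' : ℝ → ℝ, q ∈ potentialClass δ Q → q' ∈ potentialClass δ Q →
          deriv (sFun q) 0 / sFun q 0 = deriv (sFun q') 0 / sFun q' 0 →
          ∀ ε ∈ Set.Icc 0 (E Q R), ∀ η ∈ Set.Ioo ε 1,
            ∀ (N : ℕ) (a a' : Fin N → ℂ), ListsZeros (sFun q) R a → ListsZeros (sFun q') R a' →
              (∀ n, ‖a n - a' n‖ ≤ ε) →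
              ∀ z : ℝ, |z| ≤ R ^ (1 / 3 : ℝ) → (∀ n, η ≤ ‖(z : ℂ) - a n‖) →
                ‖sFun q z - sFun q' z‖ ≤
                  C Q δ * (η⁻¹ * ε * N + R ^ (-(1 / 3) : ℝ) + (1 + |z|) * ε * N +
                    ‖sFun q 0 - sFun q' 0‖) := by
  -- `M` bounds `s` on the real line, `c₀` bounds its zeros from below, and `K` is the Hadamard
  -- error constant, both for type `4`. The threshold `8` gives `R^(1/3) ≥ 2`, hence `R^(1/3) < R /
  -- 2`. The summands of `C` match the five terms of `norm_sub_le_of_products`. Large deviations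
  -- being covered by the trivial bound there, `E` may be `1`.
  let M : ℝ → ℝ := fun Q => Q * Real.exp (2 * Q)
  let c₀ : ℝ → ℝ → ℝ := fun Q δ => min 1 (δ / (2 * (M Q * Real.exp 4)))
  let K : ℝ → ℝ → ℝ := fun Q δ => 2 * 4 + |Real.log (M Q / δ)|
  refine ⟨fun _ _ => 8, fun Q δ => 2 * M Q * (δ⁻¹ + 1 + (c₀ Q δ)⁻¹ + (c₀ Q δ ^ 2)⁻¹ +
    32 * K Q δ), fun _ _ => 1, fun Q δ hQ hδ => ?_⟩
  have hM : 0 < M Q := by positivity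
  have hc₀ : 0 < c₀ Q δ := lt_min one_pos (by positivity)
  have hK : 0 < K Q δ := by positivity
  refine ⟨by norm_num, by positivity, fun R hR => ⟨one_pos, ?_⟩⟩
  intro q q' hq hq' hc ε hε η hη N a a' ha ha' haa' z hz hza
  have hR0 : 0 < R := by linarith
  have hη0 : 0 < η := hε.1.trans_lt hη.1
  have hbound : ∀ {q}, q ∈ potentialClass δ Q → ∀ z, ‖sFun q z‖ ≤ M Q * Real.exp (4 * ‖z‖) :=
    fun h z => (norm_sFun_le h.1 h.2.1 z).trans (by
      have := Complex.abs_im_le_norm z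
      gcongr)
  have hreal : ∀ {q}, q ∈ potentialClass δ Q → ‖sFun q z‖ ≤ M Q := fun h => by
    simpa using norm_sFun_le h.1 h.2.1 (z : ℂ)
  set ρ := R ^ (1 / 3 : ℝ) with hρ
  have hρ0 : 0 < ρ := Real.rpow_pos_of_pos hR0 _
  have hρ3 : ρ ^ 3 = R := by
    rw [hρ, ← Real.rpow_natCast, ← Real.rpow_mul hR0.le]; norm_num
  have hρ2 : 2 ≤ ρ := by
    by_contra! h
    have : ρ ^ 3 < 2 ^ 3 := by gcongr
    linarith
  have hρinv : R ^ (-(1 / 3) : ℝ) = ρ⁻¹ := by rw [Real.rpow_neg hR0.le]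
  have hzn : ‖(z : ℂ)‖ = |z| := Complex.norm_real z
  have hzR : ‖(z : ℂ)‖ < R / 2 := by
    have h4 : 2 * 2 ≤ ρ * ρ := by gcongr
    have h5 : ρ * (2 * 2) ≤ ρ * (ρ * ρ) := by gcongr
    have h6 : ρ ^ 3 = ρ * (ρ * ρ) := by ring
    rw [hzn]
    linarith
  -- The exponent `1/3` balances the error: `ρ² / ρ³ = ρ⁻¹`.
  have hzsq : ‖(z : ℂ)‖ ^ 2 / R ≤ ρ⁻¹ := by
    rw [hzn, div_le_iff₀ hR0, ← hρ3]
    calc |z| ^ 2 ≤ ρ ^ 2 := by gcongr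
      _ = _ := by field_simp
  have hzero : ∀ {q} {a : Fin N → ℂ}, q ∈ potentialClass δ Q → ListsZeros (sFun q) R a →
      ∀ n, c₀ Q δ ≤ ‖a n‖ := fun {q a} h hl n =>
    le_norm_of_zero (differentiable_sFun h.1) hM (by norm_num) (hbound h) h.2.2 (by
      apply apply_eq_zero_of_analyticOrderAt_ne_zero (𝕜 := ℂ)
      rw [← hl.2 _ (hl.1 n)]
      have : Nonempty {m : Fin N // a m = a n} := ⟨⟨n, rfl⟩⟩
      exact_mod_cast Nat.card_pos.ne')
  obtain ⟨r, hr, hs⟩ := exists_truncated_hadamard (differentiable_sFun hq.1) hM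
    (by norm_num : (0 : ℝ) < 4) hδ (by linarith) (hbound hq) hq.2.2 ha hzR
  obtain ⟨r', hr', hs'⟩ := exists_truncated_hadamard (differentiable_sFun hq'.1) hM
    (by norm_num : (0 : ℝ) < 4) hδ (by linarith) (hbound hq') hq'.2.2 ha' hzR
  have hrK : 16 * (2 * 4 + |Real.log (M Q / δ)|) * ‖(z : ℂ)‖ ^ 2 / R ≤ 16 * K Q δ * ρ⁻¹ := by
    rw [mul_div_assoc]; gcongr
  -- Equality of the logarithmic derivatives at `0` gives both factorizations the same constant `c`,
  -- so the linear exponents differ only through the zeros.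
  rw [← hc] at hs'
  have key := norm_sub_le_of_products hδ hc₀ hε.1 hη0 hq.2.2 (hzero hq ha) (hzero hq' ha') haa' hza
    (hr.trans hrK) (hr'.trans hrK) (hreal hq) (hreal hq') hs hs'
  refine key.trans ?_
  rw [hρinv, hzn, mul_assoc (2 * M Q)]
  refine mul_le_mul_of_nonneg_left ?_ (by positivity)
  set D := ‖sFun q 0 - sFun q' 0‖
  have hD : 0 ≤ D := norm_nonneg _
  have hε0 := hε.1
  have hz0 := abs_nonneg z
  have hA : 0 ≤ η⁻¹ * ε * N := by positivity
  have hB : 0 ≤ (1 + |z|) * ε * N := by positivity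
  have hρi : 0 < ρ⁻¹ := by positivity
  set S := η⁻¹ * ε * N + ρ⁻¹ + (1 + |z|) * ε * N + D with hS
  have t1 : D / δ ≤ δ⁻¹ * S := by
    rw [div_eq_inv_mul]; gcongr; linarith
  have t2 : N * (ε / η) ≤ 1 * S := by
    have : N * (ε / η) = η⁻¹ * ε * N := by ring
    linarith
  have hεN : 0 ≤ ε * N := by positivity
  have t3 : N * (ε / c₀ Q δ) ≤ (c₀ Q δ)⁻¹ * S := by
    have : N * (ε / c₀ Q δ) = (c₀ Q δ)⁻¹ * (ε * N) := by ring
    rw [this]; gcongr; nlinarith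
  have t4 : N * (ε / c₀ Q δ ^ 2) * |z| ≤ (c₀ Q δ ^ 2)⁻¹ * S := by
    have : N * (ε / c₀ Q δ ^ 2) * |z| = (c₀ Q δ ^ 2)⁻¹ * (|z| * (ε * N)) := by ring
    rw [this]; gcongr; nlinarith
  have t5 : 2 * (16 * K Q δ * ρ⁻¹) ≤ 32 * K Q δ * S := by
    have : 2 * (16 * K Q δ * ρ⁻¹) = 32 * K Q δ * ρ⁻¹ := by ring
    rw [this]; gcongr; linarith
  linarith


end
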